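/- Let $r,\alpha\in\mathbb{R}$, $\sigma>0$, $\lambda\ge 0$, $0\le\mu<1$, $\gamma>0$, $K>0$, $T>0$, and let $z$ be a standard Brownian motion with respect to a filtration $(\mathcal{F}_s)_{s\ge 0}$ on a probability space (that is, $z$ is adapted and $z_u-z_s$ is independent of $\mathcal{F}_s$ for $s\le u$). Put $\delta(T,t)=e^{-r(T-t)}$, $U(x)=1-e^{-\gamma x}$, and $c(y,S)=(1-\mu)Sy$ if $y\ge 0$, $c(y,S)=(1+\lambda)Sy$ if $y<0$. Given $t\in[0,T]$ and $(X,y,S)\in\mathbb{R}\times\mathbb{R}\times\mathbb{R}^+$ (where $\mathbb{R}^+=(0,\infty)$), let $\bar S$ be the solution of $d\bar S=\alpha\bar S\,ds+\sigma\bar S\,dz_s$ on $[t,T]$ with $\bar S(t)=S$. A trading strategy $\pi\in\tau(X,y)$ is a pair $(L,M)$ of adapted, right-continuous, nonnegative, nondecreasing processes with $L(t^-)=M(t^-)=0$ (jumps at time $t$ are allowed), together with the processes $(\bar X,\bar y)$ on $[t,T]$ that satisfy $$d\bar X=r\bar X\,ds-(1+\lambda)\bar S\,dL+(1-\mu)\bar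 S\,dM,\qquad d\bar y=dL-dM,\qquad \bar X(t^-)=X,\ \bar y(t^-)=y.$$ The net wealth at maturity is $W_1(T)=\bar X(T)+c(\bar y(T),\bar S(T))$ in scenario $j=1$ (no option sold), and in scenario $j=w$ (one European call with strike $K$ and maturity $T$ sold) it is $W_w(T)=\bar X(T)+c(\bar y(T),\bar S(T))$ if $\bar S(T)<K$ and $W_w(T)=\bar X(T)+K+c(\bar y(T)-1,\bar S(T))$ if $\bar S(T)\ge K$. For $E>0$ call a state $(X,y,S)$ at time $s$ solvent if $(X+c(y-1,S))e^{r(T-s)}>-E$. The value function with bankruptcy state is $$V_j^{B_E}(t,X,y,S)=\sup_{\pi\in\tau(X,y)}\mathbb{E}\bigl[U(W_j(T))\mathbf{1}_{A_\pi}+(1-e^{\gamma E})\mathbf{1}_{A_\pi^c}\bigr]$$ if $(X,y,S)$ is solvent at time $t$, where $A_\pi$ is the event that $(\bar X(s),\bar y(s),\bar S(s))$ is solvent at every time $s\in[t,T]$; and $V_j^{B_E}(t,X,y,S)=1-e^{\gamma E}$ otherwise. For $X_0\in\mathbb{R}$ the reduced value function $Q_j^{B_{E,X_0}}(t,y,S)$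 is defined by $$V_j^{B_E}(t,X_0,y,S)=1-\exp\Bigl(-\gamma\frac{X_0}{\delta(T,t)}\Bigr)Q_j^{B_{E,X_0}}(t,y,S).$$ Then for every $X_0\in\mathbb{R}$ and $E_0>0$ there is $M=M(X_0,E_0)\ge 0$ such that $$0<Q_j^{B_{E_0,X_0}}(t,y,S)\le M\qquad\text{for all }(t,y,S)\in[0,T]\times\mathbb{R}\times\mathbb{R}^+\text{ and } j\in\{1,w\}.$$ -/

import Mathlib

open MeasureTheory ProbabilityTheory
open scoped NNReal

/-- The constants of the market: interest rate `r`, rate of return `α` and volatility `σ` of the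
stock, proportional costs `lam` (purchases) and `mu` (sales), risk aversion `γ`, strike `K` and
maturity `T`. -/
structure MarketParams where
  r : ℝ
  α : ℝ
  σ : ℝ
  lam : ℝ
  mu : ℝ
  γ : ℝ
  K : ℝ
  T : ℝ

/-- The two scenarios: `one` (no option has been sold) and `w` (one European call has been sold). -/
inductive Scenario where
  | one : Scenario
  | w : Scenario

/-- `z` is a standard Brownian motion with respect to the filtration `F`. -/
structure IsFilteredBrownian {Ω : Type*} {mΩ : MeasurableSpace Ω} (P : Measure Ω)
    (F : Filtration ℝ≥0 mΩ) (z : ℝ≥0 → Ω → ℝ) : Prop where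
  isBrownian : IsBrownianReal z P
  adapted : ∀ u : ℝ≥0, Measurable[F u] (z u)
  indep_increments : ∀ s u : ℝ≥0, s ≤ u →
    Indep (F s) (MeasurableSpace.comap (fun ω ↦ z u ω - z s ω) inferInstance) P

noncomputable section

namespace MarketParams

variable (p : MarketParams)

/-- Discount factor `δ(T,t)`. -/
def discount (t : ℝ) : ℝ := Real.exp (-(p.r * (p.T - t)))

/-- Exponential utility. -/
def utility (x : ℝ) : ℝ := 1 - Real.exp (-(p.γ * x))

/-- Liquidated cash value `c(y,S)` of `y` shares at price `S`. -/
def cashValue (y S : ℝ) : ℝ :=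
  if 0 ≤ y then (1 - p.mu) * S * y else (1 + p.lam) * S * y

/-- Net wealth at maturity `W_j(T)`, as a function of the terminal bank account, number of shares
and stock price. -/
def terminalWealth (j : Scenario) (X y S : ℝ) : ℝ :=
  match j with
  | .one => X + p.cashValue y S
  | .w => if S < p.K then X + p.cashValue y S else X + p.K + p.cashValue (y - 1) S

/-- The state `(X,y,S)`, attained at time `t`, satisfies the solvency constraint with bound `E`. -/
def Solvent (E t X y S : ℝ) : Prop :=
  -E < (X + p.cashValue (y - 1) S) * Real.exp (p.r * (p.T - t))

variable {Ω : Type*} {mΩ : MeasurableSpace Ω}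

/-- The stock price at time `s`, started from `S` at time `t`: the geometric Brownian motion
that solves `dS = α S ds + σ S dz`. -/
def stock (z : ℝ≥0 → Ω → ℝ) (t S s : ℝ) (ω : Ω) : ℝ :=
  S * Real.exp ((p.α - p.σ ^ 2 / 2) * (s - t) + p.σ * (z s.toNNReal ω - z t.toNNReal ω))

/-- A trading strategy on `[t,T]` started from the position `(X,y)` just before time `t`, when the
stock price at time `t` is `S`. `L` and `M` are the cumulative numbers of shares bought and sold:
each path is nondecreasing and right-continuous and vanishes before `t`, so that a jump at `t`
itself is an atom at `t` of the associated Stieltjes measure. No solvency condition is imposed. -/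
structure Strategy (P : Measure Ω) (F : Filtration ℝ≥0 mΩ) (z : ℝ≥0 → Ω → ℝ)
    (t X y S : ℝ) where
  L : Ω → StieltjesFunction ℝ
  M : Ω → StieltjesFunction ℝ
  bank : ℝ → Ω → ℝ
  shares : ℝ → Ω → ℝ
  L_before : ∀ ω, ∀ s < t, L ω s = 0
  M_before : ∀ ω, ∀ s < t, M ω s = 0
  L_adapted : ∀ s ∈ Set.Icc t p.T, Measurable[F s.toNNReal] (fun ω ↦ L ω s)
  M_adapted : ∀ s ∈ Set.Icc t p.T, Measurable[F s.toNNReal] (fun ω ↦ M ω s)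
  bank_adapted : ∀ s ∈ Set.Icc t p.T, Measurable[F s.toNNReal] (bank s)
  bank_eq : ∀ᵐ ω ∂P, ∀ s ∈ Set.Icc t p.T,
    bank s ω = X + (∫ u in t..s, p.r * bank u ω)
      - (1 + p.lam) * (∫ u in Set.Icc t s, p.stock z t S u ω ∂(L ω).measure)
      + (1 - p.mu) * (∫ u in Set.Icc t s, p.stock z t S u ω ∂(M ω).measure)
  shares_eq : ∀ ω, ∀ s ∈ Set.Icc t p.T, shares s ω = y + L ω s - M ω s

open Classical in
/-- Utility obtained along the path `ω`: the utility of the terminal wealth if the investor is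
solvent at all times of `[t,T]`, and the residual bankruptcy utility `1 - exp (γ E)` if at some time
the strategy has led outside the solvency region. -/
def outcome {P : Measure Ω} {F : Filtration ℝ≥0 mΩ} {z : ℝ≥0 → Ω → ℝ} {t X y S : ℝ}
    (j : Scenario) (E : ℝ) (π : p.Strategy P F z t X y S) (ω : Ω) : ℝ :=
  if ∀ s ∈ Set.Icc t p.T, p.Solvent E s (π.bank s ω) (π.shares s ω) (p.stock z t S s ω) then
    p.utility (p.terminalWealth j (π.bank p.T ω) (π.shares p.T ω) (p.stock z t S p.T ω))
  else 1 - Real.exp (p.γ * E)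

open Classical in
/-- The value function `V^{B_E}_j(t,X,y,S)` with bankruptcy state. -/
def valueB (P : Measure Ω) (F : Filtration ℝ≥0 mΩ) (z : ℝ≥0 → Ω → ℝ)
    (j : Scenario) (E t X y S : ℝ) : ℝ :=
  if p.Solvent E t X y S then
    ⨆ π : p.Strategy P F z t X y S, ∫ ω, p.outcome j E π ω ∂P
  else 1 - Real.exp (p.γ * E)

/-- The reduced value function `Q^{B_{E,X₀}}_j(t,y,S)`, that is, the solution `Q` of
`V^{B_E}_j(t,X₀,y,S) = 1 - exp (-γ X₀ / δ(T,t)) * Q`. -/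
def reducedB (P : Measure Ω) (F : Filtration ℝ≥0 mΩ) (z : ℝ≥0 → Ω → ℝ)
    (j : Scenario) (E X₀ t y S : ℝ) : ℝ :=
  (1 - p.valueB P F z j E t X₀ y S) / Real.exp (-(p.γ * (X₀ / p.discount t)))

end MarketParams

end

/-!
A value function bounded above by `1` could still reach `1`: utility `1` is approached by
strategies whose terminal wealth is arbitrarily large. Solvency excludes this. Under the measure
with density `exp (-θ (z_T - z_t) - θ² (T - t) / 2)`, `θ = (α - r) / σ`, the discounted stock
price is a martingale, and transaction costs only lower the wealth below that of a frictionless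
portfolio with the same stock holdings. The discounted frictionless gain of a strategy is bounded
below until bankruptcy, so by Markov's inequality it stays below a fixed level with a probability
that, under the new measure, is bounded away from `0` uniformly in the strategy. The density has
second moment `exp (θ² (T - t))`, so the Cauchy–Schwarz inequality carries this bound back to `P`.
Hence the expected utility stays uniformly below `1`. Since the trading gains are pathwise
Stieltjes integrals, portfolios rebalanced on finite grids and stopped at bankruptcy suffice, and
no stochastic integral is needed.

The upper bound on `Q` holds because the utility of a solvent strategy never drops below the
bankruptcy value `1 - exp (γ E)`.
-/

section LinearIntegralEquation

theorem hasDerivAt_exp_neg_mul_sub (r t v : ℝ) :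
    HasDerivAt (fun v ↦ Real.exp (-(r * (v - t)))) (-r * Real.exp (-(r * (v - t)))) v :=
  ((((hasDerivAt_id v).sub_const t).const_mul r).neg.exp).congr_deriv (by simp [mul_comm])

theorem setIntegral_Icc_eq_integral_indicator_Iic {t s v : ℝ} (hv : v ≤ s) (g : ℝ → ℝ)
    (ν : Measure ℝ) :
    ∫ u in Set.Icc t v, g u ∂ν = ∫ u in Set.Icc t s, (Set.Iic v).indicator g u ∂ν := by
  rw [setIntegral_indicator measurableSet_Iic]
  congr 2
  ext u
  simp only [Set.mem_Icc, Set.mem_inter_iff, Set.mem_Iic]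
  exact ⟨fun h ↦ ⟨⟨h.1, h.2.trans hv⟩, h.2⟩, fun h ↦ ⟨h.1.1, h.2⟩⟩

theorem integrable_prod_mul_indicator_Iic {t s : ℝ} {D' g : ℝ → ℝ} (hD' : Continuous D')
    {ν : Measure ℝ} [SFinite ν] (hg : IntegrableOn g (Set.Icc t s) ν) :
    Integrable (fun q : ℝ × ℝ ↦ D' q.1 * (Set.Iic q.1).indicator g q.2)
      ((volume.restrict (Set.Ioc t s)).prod (ν.restrict (Set.Icc t s))) := by
  have hD'_int : IntegrableOn D' (Set.Ioc t s) := hD'.integrableOn_Ioc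
  have hind := (hD'_int.mul_prod hg).indicator (s := {q : ℝ × ℝ | q.2 ≤ q.1})
    (measurableSet_le measurable_snd measurable_fst)
  refine hind.congr (.of_forall fun q ↦ ?_)
  by_cases h : q.2 ≤ q.1 <;> simp [h]

theorem intervalIntegrable_setIntegral_Icc {t s : ℝ} (hts : t ≤ s) {g : ℝ → ℝ}
    {ν : Measure ℝ} [SFinite ν] (hg : IntegrableOn g (Set.Icc t s) ν) :
    IntervalIntegrable (fun v ↦ ∫ u in Set.Icc t v, g u ∂ν) volume t s := by
  rw [intervalIntegrable_iff_integrableOn_Ioc_of_le hts]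
  refine (integrable_prod_mul_indicator_Iic (continuous_const (y := 1)) hg).integral_prod_left.congr
    ((ae_restrict_mem measurableSet_Ioc).mono fun v hv ↦ ?_)
  simp only [one_mul, setIntegral_Icc_eq_integral_indicator_Iic hv.2 g ν]

theorem integral_deriv_mul_setIntegral_Icc {t s : ℝ} (hts : t ≤ s) {D D' g : ℝ → ℝ}
    (hD : ∀ v, HasDerivAt D (D' v) v) (hD' : Continuous D') {ν : Measure ℝ} [SFinite ν]
    (hg : IntegrableOn g (Set.Icc t s) ν) :
    ∫ v in t..s, D' v * ∫ u in Set.Icc t v, g u ∂ν =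
      ∫ u in Set.Icc t s, (D s - D u) * g u ∂ν := by
  have hinner : ∀ u ∈ Set.Icc t s,
      ∫ v in Set.Ioc t s, D' v * (Set.Iic v).indicator g u = (D s - D u) * g u := by
    intro u hu
    have hset : Set.Icc u s = Set.Icc t s ∩ Set.Ici u := by
      rw [← Set.Ici_inter_Iic, ← Set.Ici_inter_Iic, Set.inter_right_comm, Set.Ici_inter_Ici,
        sup_eq_right.2 hu.1]
    rw [← intervalIntegral.integral_eq_sub_of_hasDerivAt (fun v _ ↦ hD v)
      (hD'.intervalIntegrable u s), intervalIntegral.integral_of_le hu.2,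
      ← integral_Icc_eq_integral_Ioc, ← integral_Icc_eq_integral_Ioc, ← integral_mul_const,
      hset, ← setIntegral_indicator measurableSet_Ici]
    refine integral_congr_ae (.of_forall fun v ↦ ?_)
    by_cases h : u ≤ v <;> simp [h]
  calc ∫ v in t..s, D' v * ∫ u in Set.Icc t v, g u ∂ν
      = ∫ v in Set.Ioc t s, ∫ u in Set.Icc t s, D' v * (Set.Iic v).indicator g u ∂ν := by
        rw [intervalIntegral.integral_of_le hts]
        refine setIntegral_congr_fun measurableSet_Ioc fun v hv ↦ ?_
        simp only [integral_const_mul, setIntegral_Icc_eq_integral_indicator_Iic hv.2 g ν]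
    _ = ∫ u in Set.Icc t s, (∫ v in Set.Ioc t s, D' v * (Set.Iic v).indicator g u) ∂ν :=
        integral_integral_swap (integrable_prod_mul_indicator_Iic hD' hg)
    _ = ∫ u in Set.Icc t s, (D s - D u) * g u ∂ν :=
        setIntegral_congr_fun measurableSet_Icc hinner

theorem exp_mul_eq_of_eq_mul_integral_add {r t s : ℝ} (hts : t ≤ s) {b V : ℝ → ℝ}
    (hb : IntervalIntegrable b volume t s) (hV : IntervalIntegrable V volume t s)
    (hbV : ∀ v ∈ Set.Icc t s, b v = r * (∫ u in t..v, b u) + V v) :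
    Real.exp (-(r * (s - t))) * b s = Real.exp (-(r * (s - t))) * V s
      + r * ∫ u in t..s, Real.exp (-(r * (u - t))) * V u := by
  set D : ℝ → ℝ := fun v ↦ Real.exp (-(r * (v - t)))
  have hDcont : Continuous D := by fun_prop
  have hDb : ∀ v ∈ Set.Icc t s, D v * b v = D v * V v - -r * D v * ∫ u in t..v, b u :=
    fun v hv ↦ by rw [hbV v hv]; ring
  have hparts : ∫ v in t..s, -r * D v * ∫ u in t..v, b u =
      D s * (∫ u in t..s, b u) - ∫ u in t..s, D u * b u := by
    have hbs := hb
    rw [intervalIntegrable_iff_integrableOn_Icc_of_le hts] at hbs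
    have h := integral_deriv_mul_setIntegral_Icc hts (hasDerivAt_exp_neg_mul_sub r t)
      (by fun_prop) hbs
    rw [integral_Icc_eq_integral_Ioc, ← intervalIntegral.integral_of_le hts] at h
    simp only [sub_mul] at h
    rw [intervalIntegral.integral_sub (hb.const_mul _) (hb.continuousOn_mul hDcont.continuousOn),
      intervalIntegral.integral_const_mul] at h
    rw [← h]
    refine intervalIntegral.integral_congr fun v hv ↦ ?_
    rw [Set.uIcc_of_le hts] at hv
    simp only [intervalIntegral.integral_of_le hv.1, integral_Icc_eq_integral_Ioc, D]
  have hprimitive : IntervalIntegrable (fun v ↦ -r * D v * ∫ u in t..v, b u) volume t s := by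
    refine (ContinuousOn.mul (by fun_prop) ?_).intervalIntegrable
    exact intervalIntegral.continuousOn_primitive_interval' hb Set.left_mem_uIcc
  have hsplit : ∫ u in t..s, D u * b u =
      (∫ u in t..s, D u * V u) - ∫ v in t..s, -r * D v * ∫ u in t..v, b u := by
    rw [← intervalIntegral.integral_sub (hV.continuousOn_mul hDcont.continuousOn) hprimitive]
    refine intervalIntegral.integral_congr fun v hv ↦ ?_
    rw [Set.uIcc_of_le hts] at hv
    exact hDb v hv
  rw [hbV s ⟨hts, le_rfl⟩]
  linear_combination r * hsplit - r * hparts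

/-- No integrability of `b` is assumed, since a solution is automatically integrable: as long as it
is, it is given by variation of constants, and where its integral is undefined it equals `V`. -/
theorem intervalIntegrable_of_eq_mul_integral_add {r t T : ℝ} (htT : t ≤ T) {b V : ℝ → ℝ}
    (hV : IntervalIntegrable V volume t T)
    (hbV : ∀ s ∈ Set.Icc t T, b s = r * (∫ u in t..s, b u) + V s) :
    IntervalIntegrable b volume t T := by
  set D : ℝ → ℝ := fun v ↦ Real.exp (-(r * (v - t)))
  have hDV : IntervalIntegrable (fun u ↦ D u * V u) volume t T :=
    hV.continuousOn_mul (by fun_prop)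
  set Φ : ℝ → ℝ := fun s ↦ V s + Real.exp (r * (s - t)) * (r * ∫ u in t..s, D u * V u)
  have hΦ : IntervalIntegrable Φ volume t T := by
    refine hV.add (ContinuousOn.mul (by fun_prop) (continuousOn_const.mul ?_)).intervalIntegrable
    exact intervalIntegral.continuousOn_primitive_interval' hDV Set.left_mem_uIcc
  have huIcc : ∀ {v s : ℝ}, t ≤ v → v ≤ s → Set.uIcc t v ⊆ Set.uIcc t s := fun h h' ↦ by
    rw [Set.uIcc_of_le h, Set.uIcc_of_le (h.trans h')]; exact Set.Icc_subset_Icc_right h'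
  set J : Set ℝ := {s | t ≤ s ∧ IntervalIntegrable b volume t s}
  have hJ : MeasurableSet J := Set.OrdConnected.measurableSet
    ⟨fun x hx y hy v hv ↦ ⟨hx.1.trans hv.1, hy.2.mono_set (huIcc (hx.1.trans hv.1) hv.2)⟩⟩
  have hb_on : ∀ s ∈ Set.Icc t T, s ∈ J → b s = Φ s := fun s hs hsJ ↦ by
    have h := exp_mul_eq_of_eq_mul_integral_add hs.1 hsJ.2 (hV.mono_set (huIcc hs.1 hs.2))
      (fun v hv ↦ hbV v ⟨hv.1, hv.2.trans hs.2⟩)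
    have hinv : Real.exp (r * (s - t)) * Real.exp (-(r * (s - t))) = 1 := by
      rw [← Real.exp_add, add_neg_cancel, Real.exp_zero]
    linear_combination Real.exp (r * (s - t)) * h + (V s - b s) * hinv
  have hb_off : ∀ s ∈ Set.Icc t T, s ∉ J → b s = V s := fun s hs hsJ ↦ by
    rw [hbV s hs, intervalIntegral.integral_undef fun h ↦ hsJ ⟨hs.1, h⟩, mul_zero, zero_add]
  rw [intervalIntegrable_iff_integrableOn_Ioc_of_le htT] at hΦ hV ⊢
  refine ((hΦ.indicator hJ).add (hV.indicator hJ.compl)).congr_fun (fun s hs ↦ ?_)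
    measurableSet_Ioc
  by_cases hsJ : s ∈ J
  · simp [hsJ, hb_on s (Set.Ioc_subset_Icc_self hs) hsJ]
  · simp [hsJ, hb_off s (Set.Ioc_subset_Icc_self hs) hsJ]

theorem mul_integral_exp_mul_setIntegral_Icc {r t s : ℝ} (hts : t ≤ s) {g : ℝ → ℝ}
    {ν : Measure ℝ} [SFinite ν] (hg : IntegrableOn g (Set.Icc t s) ν) :
    r * (∫ u in t..s, Real.exp (-(r * (u - t))) * ∫ v in Set.Icc t u, g v ∂ν) =
      (∫ u in Set.Icc t s, Real.exp (-(r * (u - t))) * g u ∂ν)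
        - Real.exp (-(r * (s - t))) * ∫ u in Set.Icc t s, g u ∂ν := by
  have hexp_mul : IntegrableOn (fun u ↦ Real.exp (-(r * (u - t))) * g u) (Set.Icc t s) ν :=
    hg.continuousOn_mul (by fun_prop) isCompact_Icc
  have hparts := integral_deriv_mul_setIntegral_Icc hts (hasDerivAt_exp_neg_mul_sub r t)
    (by fun_prop) hg
  simp only [sub_mul, mul_assoc, intervalIntegral.integral_const_mul] at hparts
  rw [integral_sub (hg.const_mul _) hexp_mul, integral_const_mul] at hparts
  linear_combination -hparts

theorem mul_integral_exp_neg_mul_sub (r t s : ℝ) :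
    r * (∫ u in t..s, Real.exp (-(r * (u - t)))) = 1 - Real.exp (-(r * (s - t))) := by
  have h := intervalIntegral.integral_eq_sub_of_hasDerivAt (a := t) (b := s)
    (fun v _ ↦ hasDerivAt_exp_neg_mul_sub r t v)
    (Continuous.intervalIntegrable (by fun_prop) _ _)
  rw [intervalIntegral.integral_const_mul] at h
  simp only [sub_self, mul_zero, neg_zero, Real.exp_zero] at h
  linear_combination -h

theorem exp_mul_eq_of_eq_mul_integral_add_setIntegral {r t T X c d : ℝ} {g b : ℝ → ℝ}
    {ν ρ : Measure ℝ} [SFinite ν] [SFinite ρ]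
    (hν : IntegrableOn g (Set.Icc t T) ν) (hρ : IntegrableOn g (Set.Icc t T) ρ)
    (hb : ∀ s ∈ Set.Icc t T, b s = X + r * (∫ u in t..s, b u)
      - c * (∫ u in Set.Icc t s, g u ∂ν) + d * (∫ u in Set.Icc t s, g u ∂ρ)) :
    ∀ s ∈ Set.Icc t T, Real.exp (-(r * (s - t))) * b s = X
      - c * (∫ u in Set.Icc t s, Real.exp (-(r * (u - t))) * g u ∂ν)
      + d * (∫ u in Set.Icc t s, Real.exp (-(r * (u - t))) * g u ∂ρ) := by
  intro s ⟨hts, hsT⟩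
  have hν := hν.mono_set (Set.Icc_subset_Icc_right hsT)
  have hρ := hρ.mono_set (Set.Icc_subset_Icc_right hsT)
  have hνint := intervalIntegrable_setIntegral_Icc hts hν
  have hρint := intervalIntegrable_setIntegral_Icc hts hρ
  have hV := (intervalIntegrable_const (c := X).sub (hνint.const_mul c)).add (hρint.const_mul d)
  have hbV : ∀ v ∈ Set.Icc t s, b v = r * (∫ u in t..v, b u)
      + (X - c * (∫ u in Set.Icc t v, g u ∂ν) + d * ∫ u in Set.Icc t v, g u ∂ρ) :=
    fun v hv ↦ by rw [hb v ⟨hv.1, hv.2.trans hsT⟩]; ring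
  have hsplit : ∀ v, Real.exp (-(r * (v - t))) *
      (X - c * (∫ u in Set.Icc t v, g u ∂ν) + d * ∫ u in Set.Icc t v, g u ∂ρ) =
      Real.exp (-(r * (v - t))) * X
        - c * (Real.exp (-(r * (v - t))) * ∫ u in Set.Icc t v, g u ∂ν)
        + d * (Real.exp (-(r * (v - t))) * ∫ u in Set.Icc t v, g u ∂ρ) := fun v ↦ by ring
  have hexp : Continuous fun v ↦ Real.exp (-(r * (v - t))) := by fun_prop
  have hν' := (hνint.continuousOn_mul hexp.continuousOn).const_mul c
  have hρ' := (hρint.continuousOn_mul hexp.continuousOn).const_mul d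
  have hX : IntervalIntegrable (fun v ↦ Real.exp (-(r * (v - t))) * X) volume t s :=
    (hexp.mul continuous_const).intervalIntegrable t s
  rw [exp_mul_eq_of_eq_mul_integral_add hts
    (intervalIntegrable_of_eq_mul_integral_add hts hV hbV) hV hbV]
  simp only [hsplit]
  rw [intervalIntegral.integral_add (hX.sub hν') hρ', intervalIntegral.integral_sub hX hν']
  simp only [intervalIntegral.integral_const_mul, intervalIntegral.integral_mul_const]
  linear_combination X * mul_integral_exp_neg_mul_sub r t s
    - c * mul_integral_exp_mul_setIntegral_Icc (r := r) hts hν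
    + d * mul_integral_exp_mul_setIntegral_Icc (r := r) hts hρ

end LinearIntegralEquation

section RiemannSum

theorem abs_sub_setIntegral_Ioc_le {L : StieltjesFunction ℝ} {A : ℝ → ℝ} (hA : Continuous A)
    {a b ε : ℝ} (hab : a ≤ b) (hosc : ∀ u ∈ Set.Ioc a b, |A b - A u| ≤ ε) :
    |(L b - L a) * A b - ∫ u in Set.Ioc a b, A u ∂L.measure| ≤ ε * (L b - L a) := by
  have hfin : L.measure (Set.Ioc a b) < ⊤ := by rw [L.measure_Ioc]; exact ENNReal.ofReal_lt_top
  have hmeas : L.measure.real (Set.Ioc a b) = L b - L a := by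
    rw [Measure.real, L.measure_Ioc, ENNReal.toReal_ofReal (sub_nonneg.2 (L.mono hab))]
  have hconst : IntegrableOn (fun _ ↦ A b) (Set.Ioc a b) L.measure := integrableOn_const hfin.ne
  have hintegral : (L b - L a) * A b - ∫ u in Set.Ioc a b, A u ∂L.measure =
      ∫ u in Set.Ioc a b, (A b - A u) ∂L.measure := by
    rw [integral_sub hconst hA.integrableOn_Ioc, setIntegral_const, hmeas,
      smul_eq_mul]
  rw [hintegral, ← hmeas, ← Real.norm_eq_abs]
  exact norm_setIntegral_le_of_norm_le_const hfin hosc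

theorem nonneg_of_monotone_of_eq_zero_before {f : ℝ → ℝ} (hf : Monotone f) {a : ℝ}
    (hfa : ∀ s < a, f s = 0) (s : ℝ) : 0 ≤ f s := by
  rw [← hfa (min s (a - 1)) ((min_le_right _ _).trans_lt (sub_one_lt a))]
  exact hf (min_le_left _ _)

theorem setIntegral_singleton_eq_of_eq_zero_before {L : StieltjesFunction ℝ} {a : ℝ}
    (hL : ∀ s < a, L s = 0) (A : ℝ → ℝ) : ∫ u in {a}, A u ∂L.measure = L a * A a := by
  have hleft : Function.leftLim L a = 0 := leftLim_eq_of_tendsto <| tendsto_const_nhds.congr' <| by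
    filter_upwards [self_mem_nhdsWithin] with s hs using (hL s hs).symm
  rw [integral_singleton, Measure.real, L.measure_singleton, hleft, sub_zero,
    ENNReal.toReal_ofReal (nonneg_of_monotone_of_eq_zero_before L.mono hL a), smul_eq_mul]

theorem abs_sub_setIntegral_Icc_sub_sum_le {L : StieltjesFunction ℝ} {A : ℝ → ℝ}
    (hA : Continuous A) {τ : ℕ → ℝ} (hτ : Monotone τ) (hL : ∀ s < τ 0, L s = 0) {ε : ℝ}
    (hε : 0 ≤ ε) {m : ℕ}
    (hosc : ∀ k < m, ∀ u ∈ Set.Ioc (τ k) (τ (k + 1)), |A (τ (k + 1)) - A u| ≤ ε) :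
    |L (τ m) * A (τ m) - (∫ u in Set.Icc (τ 0) (τ m), A u ∂L.measure)
      - ∑ k ∈ Finset.range m, L (τ k) * (A (τ (k + 1)) - A (τ k))| ≤ ε * L (τ m) := by
  induction m with
  | zero =>
    simp only [Set.Icc_self, setIntegral_singleton_eq_of_eq_zero_before hL, sub_self,
      Finset.range_zero, Finset.sum_empty, abs_zero]
    exact mul_nonneg hε (nonneg_of_monotone_of_eq_zero_before L.mono hL _)
  | succ m ih =>
    have hinit := ih fun k hk ↦ hosc k (hk.trans m.lt_succ_self)
    have hstep := abs_sub_setIntegral_Ioc_le (L := L) hA (hτ m.le_succ) (hosc m m.lt_succ_self)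
    have hsplit : ∫ u in Set.Icc (τ 0) (τ (m + 1)), A u ∂L.measure =
        (∫ u in Set.Icc (τ 0) (τ m), A u ∂L.measure)
          + ∫ u in Set.Ioc (τ m) (τ (m + 1)), A u ∂L.measure := by
      rw [← Set.Icc_union_Ioc_eq_Icc (hτ m.zero_le) (hτ m.le_succ), setIntegral_union _
        measurableSet_Ioc hA.integrableOn_Icc hA.integrableOn_Ioc]
      exact Set.disjoint_left.2 fun u hu hu' ↦ hu'.1.not_ge hu.2
    rw [hsplit, Finset.sum_range_succ]
    rw [abs_le] at hinit hstep ⊢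
    constructor <;> linarith [hinit.1, hinit.2, hstep.1, hstep.2]

end RiemannSum

section TimeGrid

/-- The `k`-th point of the uniform partition of `[t, T]` into `n` intervals. -/
noncomputable def timeGrid (t T : ℝ) (n k : ℕ) : ℝ := t + k * ((T - t) / n)

variable {t T : ℝ} {n : ℕ}

theorem timeGrid_zero (t T : ℝ) (n : ℕ) : timeGrid t T n 0 = t := by simp [timeGrid]

theorem timeGrid_self (hn : n ≠ 0) : timeGrid t T n n = T := by
  have : (n : ℝ) ≠ 0 := Nat.cast_ne_zero.2 hn
  simp only [timeGrid]
  field_simp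
  ring

theorem timeGrid_succ_sub (t T : ℝ) (n k : ℕ) :
    timeGrid t T n (k + 1) - timeGrid t T n k = (T - t) / n := by
  simp only [timeGrid]
  push_cast
  ring

theorem monotone_timeGrid (htT : t ≤ T) : Monotone (timeGrid t T n) :=
  monotone_nat_of_le_succ fun k ↦ by
    have := timeGrid_succ_sub t T n k
    have : 0 ≤ (T - t) / n := div_nonneg (sub_nonneg.2 htT) n.cast_nonneg
    linarith

theorem timeGrid_mem_Icc (htT : t ≤ T) {k : ℕ} (hk : k ≤ n) :
    timeGrid t T n k ∈ Set.Icc t T := by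
  refine ⟨(timeGrid_zero t T n).symm.trans_le (monotone_timeGrid htT k.zero_le), ?_⟩
  rcases eq_or_ne n 0 with rfl | hn
  · simpa [timeGrid] using htT
  · exact (monotone_timeGrid htT hk).trans_eq (timeGrid_self hn)

end TimeGrid

section TradingGain

/-- The gain over the first `m` periods from holding `q k` units of an asset priced `A k` during
the `k`-th period. -/
noncomputable def tradingGain (q A : ℕ → ℝ) (m : ℕ) : ℝ :=
  ∑ k ∈ Finset.range m, q k * (A (k + 1) - A k)

open Classical in
/-- The position `q` liquidated as soon as its accumulated gain drops below `-a` or its size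
exceeds `N`. -/
noncomputable def stoppedPosition (a N : ℝ) (q A : ℕ → ℝ) (k : ℕ) : ℝ :=
  if ∀ i ≤ k, -a ≤ tradingGain q A i ∧ |q i| ≤ N then q k else 0

variable {a N : ℝ} {q A : ℕ → ℝ}

theorem abs_stoppedPosition_le (hN : 0 ≤ N) (k : ℕ) : |stoppedPosition a N q A k| ≤ N := by
  unfold stoppedPosition
  split_ifs with h
  · exact (h k le_rfl).2
  · simpa using hN

theorem tradingGain_stoppedPosition_eq {m : ℕ}
    (h : ∀ i < m, -a ≤ tradingGain q A i ∧ |q i| ≤ N) :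
    tradingGain (stoppedPosition a N q A) A m = tradingGain q A m :=
  Finset.sum_congr rfl fun k hk ↦ by
    rw [stoppedPosition, if_pos fun i hi ↦ h i (hi.trans_lt (Finset.mem_range.1 hk))]

theorem stoppedPosition_eq_zero_of_le {k m : ℕ} (hkm : k ≤ m)
    (h : ¬∀ i ≤ k, -a ≤ tradingGain q A i ∧ |q i| ≤ N) : stoppedPosition a N q A m = 0 :=
  if_neg fun h' ↦ h fun i hi ↦ h' i (hi.trans hkm)

/-- Only the last period before liquidation can take the gain below `-a`; its contribution is
controlled by the fourth powers of the price increments, as `-x ≤ 1 + x ^ 4`. -/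
theorem neg_le_tradingGain_stoppedPosition (ha : 0 ≤ a) (hN : 0 ≤ N) (m : ℕ) :
    -(a + 1 + N ^ 4 * ∑ k ∈ Finset.range m, (A (k + 1) - A k) ^ 4) ≤
      tradingGain (stoppedPosition a N q A) A m := by
  induction m with
  | zero => simpa [tradingGain] using by linarith
  | succ m ih =>
    have hfourth : 0 ≤ N ^ 4 * (A (m + 1) - A m) ^ 4 := by positivity
    have hstep : tradingGain (stoppedPosition a N q A) A (m + 1) =
        tradingGain (stoppedPosition a N q A) A m
          + stoppedPosition a N q A m * (A (m + 1) - A m) := Finset.sum_range_succ ..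
    rw [hstep, Finset.sum_range_succ]
    by_cases hm : ∀ i ≤ m, -a ≤ tradingGain q A i ∧ |q i| ≤ N
    · set x := stoppedPosition a N q A m * (A (m + 1) - A m) with hx
      have hgain := (hm m le_rfl).1
      rw [← tradingGain_stoppedPosition_eq fun i hi ↦ hm i hi.le] at hgain
      have hpos4 : stoppedPosition a N q A m ^ 4 ≤ N ^ 4 := by
        rw [← Even.pow_abs (by decide)]
        exact pow_le_pow_left₀ (abs_nonneg _) (abs_stoppedPosition_le hN m) 4
      have hx4 : x ^ 4 ≤ N ^ 4 * (A (m + 1) - A m) ^ 4 := by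
        rw [hx, mul_pow]
        exact mul_le_mul_of_nonneg_right hpos4 (by positivity)
      have hxlow : -(1 + x ^ 4) ≤ x := by nlinarith [sq_nonneg (x ^ 2 - 1), sq_nonneg (x + 1)]
      have hsum : 0 ≤ N ^ 4 * ∑ k ∈ Finset.range m, (A (k + 1) - A k) ^ 4 := by positivity
      linarith
    · rw [stoppedPosition_eq_zero_of_le le_rfl hm, zero_mul]
      linarith

theorem measurable_tradingGain {Ω : Type*} {_ : MeasurableSpace Ω} {q A : ℕ → Ω → ℝ} {m : ℕ}
    (hq : ∀ k < m, Measurable (q k)) (hA : ∀ k ≤ m, Measurable (A k)) :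
    Measurable fun ω ↦ tradingGain (q · ω) (A · ω) m :=
  Finset.measurable_fun_sum _ fun k hk ↦
    have hk := Finset.mem_range.1 hk
    (hq k hk).mul ((hA (k + 1) hk).sub (hA k hk.le))

theorem measurable_stoppedPosition {Ω : Type*} {_ : MeasurableSpace Ω} {q A : ℕ → Ω → ℝ} {m : ℕ}
    (a N : ℝ) (hq : ∀ k ≤ m, Measurable (q k)) (hA : ∀ k ≤ m, Measurable (A k)) :
    Measurable fun ω ↦ stoppedPosition a N (q · ω) (A · ω) m := by
  refine Measurable.ite ?_ (hq m le_rfl) measurable_const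
  simp only [Set.ofPred_forall]
  refine .iInter fun i ↦ .iInter fun hi ↦ .inter ?_ ?_
  · exact measurableSet_le measurable_const (measurable_tradingGain
      (fun k hk ↦ hq k (hk.le.trans hi)) fun k hk ↦ hA k (hk.trans hi))
  · exact measurableSet_le (hq i hi).abs measurable_const

end TradingGain

section BrownianExponential

variable {Ω : Type*} {mΩ : MeasurableSpace Ω} {P : Measure Ω} {F : Filtration ℝ≥0 mΩ}
  {z : ℝ≥0 → Ω → ℝ} {s t u T : ℝ}

/-- The exponential `exp (a (z_u - z_s) + b (u - s))` of an increment of `z`; times are real numbers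
and are truncated to `ℝ≥0` when they are passed to `z`. -/
noncomputable def expIncrement (z : ℝ≥0 → Ω → ℝ) (a b s u : ℝ) (ω : Ω) : ℝ :=
  Real.exp (a * (z u.toNNReal ω - z s.toNNReal ω) + b * (u - s))

/-- The increment over `[s, u]` of the Girsanov density with market price of risk `θ`. -/
noncomputable def girsanovDensity (z : ℝ≥0 → Ω → ℝ) (θ s u : ℝ) : Ω → ℝ :=
  expIncrement z (-θ) (-(θ ^ 2 / 2)) s u

/-- The return over `[s, u]` of the discounted price with volatility `σ` and market price of risk
`θ`. -/
noncomputable def discountedReturn (z : ℝ≥0 → Ω → ℝ) (σ θ s u : ℝ) : Ω → ℝ :=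
  expIncrement z σ (σ * θ - σ ^ 2 / 2) s u

/-- The expectation of `(X - 1) ^ n` for a lognormal variable `X` of mean `1` whose logarithm has
variance `v`. -/
noncomputable def lognormalCentralMoment (n : ℕ) (v : ℝ) : ℝ :=
  ∑ k ∈ Finset.range (n + 1), Real.exp (k * (k - 1) / 2 * v) * ((-1) ^ (n - k) * n.choose k)

theorem lognormalCentralMoment_four (v : ℝ) :
    lognormalCentralMoment 4 v =
      Real.exp v ^ 6 - 4 * Real.exp v ^ 3 + 6 * Real.exp v - 3 := by
  have h : (Nat.choose 4 2 : ℝ) = 6 := by norm_num [Nat.choose]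
  simp only [lognormalCentralMoment, Finset.sum_range_succ, ← Real.exp_nat_mul]
  norm_num [h]
  ring_nf

theorem lognormalCentralMoment_four_nonneg {v : ℝ} (hv : 0 ≤ v) :
    0 ≤ lognormalCentralMoment 4 v := by
  have hx := Real.one_le_exp hv
  rw [lognormalCentralMoment_four]
  set x := Real.exp v
  have hfactor : x ^ 6 - 4 * x ^ 3 + 6 * x - 3 =
      (x - 1) ^ 2 * (x ^ 4 + 2 * x ^ 3 + 3 * (x ^ 2 - 1)) := by
    ring
  have hsq : 0 ≤ x ^ 2 - 1 := by nlinarith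
  rw [hfactor]
  positivity

theorem tendsto_mul_lognormalCentralMoment_four (c : ℝ) :
    Filter.Tendsto (fun n : ℕ ↦ n * lognormalCentralMoment 4 (c / n)) Filter.atTop (nhds 0) := by
  have hderiv : HasDerivAt (lognormalCentralMoment 4) 0 0 := by
    have hexp := Real.hasDerivAt_exp 0
    rw [Real.exp_zero] at hexp
    simp only [funext lognormalCentralMoment_four]
    refine ((((hexp.pow 6).sub ((hexp.pow 3).const_mul 4)).add
      (hexp.const_mul 6)).sub_const 3).congr_deriv ?_
    norm_num
  have hzero : lognormalCentralMoment 4 0 = 0 := by norm_num [lognormalCentralMoment_four]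
  have hlim := (hderiv.hasFDerivAt.lim_real c).comp (tendsto_natCast_atTop_atTop (R := ℝ))
  simpa [Function.comp_def, hzero, div_eq_inv_mul] using hlim

theorem expIncrement_mul_trans (a b s u v : ℝ) (ω : Ω) :
    expIncrement z a b s u ω * expIncrement z a b u v ω = expIncrement z a b s v ω := by
  simp only [expIncrement, ← Real.exp_add]
  ring_nf

theorem girsanovDensity_pos (θ s u : ℝ) (ω : Ω) : 0 < girsanovDensity z θ s u ω := Real.exp_pos _

theorem girsanovDensity_mul_discountedReturn_pow (σ θ s u : ℝ) (n : ℕ) (ω : Ω) :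
    girsanovDensity z θ s u ω * discountedReturn z σ θ s u ω ^ n =
      expIncrement z (n * σ - θ) (n * (σ * θ - σ ^ 2 / 2) - θ ^ 2 / 2) s u ω := by
  simp only [girsanovDensity, discountedReturn, expIncrement, ← Real.exp_nat_mul, ← Real.exp_add]
  ring_nf

namespace IsFilteredBrownian

theorem measurable_toNNReal (hz : IsFilteredBrownian P F z) (hsu : s ≤ u) :
    Measurable[F u.toNNReal] (z s.toNNReal) :=
  (hz.adapted _).mono (F.mono (Real.toNNReal_le_toNNReal hsu)) le_rfl

theorem measurable_increment (hz : IsFilteredBrownian P F z) (hsu : s ≤ u) :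
    Measurable[F u.toNNReal] fun ω ↦ z u.toNNReal ω - z s.toNNReal ω :=
  (hz.measurable_toNNReal le_rfl).sub (hz.measurable_toNNReal hsu)

theorem measurable_expIncrement (hz : IsFilteredBrownian P F z) (a b : ℝ) (hsu : s ≤ u) :
    Measurable[F u.toNNReal] (expIncrement z a b s u) :=
  Real.measurable_exp.comp (((hz.measurable_increment hsu).const_mul a).add_const _)

theorem hasLaw_increment (hz : IsFilteredBrownian P F z) (hs : 0 ≤ s) (hsu : s ≤ u) :
    HasLaw (fun ω ↦ z u.toNNReal ω - z s.toNNReal ω) (gaussianReal 0 (u - s).toNNReal) P := by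
  have h := hz.isBrownian.hasLaw_sub u.toNNReal s.toNNReal
  have hvar : nndist u.toNNReal.1 s.toNNReal.1 = (u - s).toNNReal := by
    rw [NNReal.val_eq_coe, NNReal.val_eq_coe,
      Real.coe_toNNReal _ (hs.trans hsu), Real.coe_toNNReal _ hs, ← NNReal.coe_inj, coe_nndist,
      Real.dist_eq, abs_of_nonneg (sub_nonneg.2 hsu), Real.coe_toNNReal _ (sub_nonneg.2 hsu)]
  rwa [hvar] at h

theorem integrable_expIncrement (hz : IsFilteredBrownian P F z) (a b : ℝ) (hs : 0 ≤ s)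
    (hsu : s ≤ u) : Integrable (expIncrement z a b s u) P := by
  have hlaw := hz.hasLaw_increment hs hsu
  have h := integrable_exp_mul_gaussianReal (μ := 0) (v := (u - s).toNNReal) a
  rw [← hlaw.map_eq] at h
  refine ((h.comp_aemeasurable hlaw.aemeasurable).mul_const (Real.exp (b * (u - s)))).congr ?_
  exact .of_forall fun ω ↦ (Real.exp_add _ _).symm

theorem integral_expIncrement (hz : IsFilteredBrownian P F z) (a b : ℝ) (hs : 0 ≤ s)
    (hsu : s ≤ u) :
    ∫ ω, expIncrement z a b s u ω ∂P = Real.exp ((a ^ 2 / 2 + b) * (u - s)) := by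
  have hmgf := mgf_gaussianReal (hz.hasLaw_increment hs hsu).map_eq a
  simp only [mgf, Real.coe_toNNReal _ (sub_nonneg.2 hsu)] at hmgf
  simp only [expIncrement, Real.exp_add, integral_mul_const, hmgf]
  rw [← Real.exp_add, ← Real.exp_add]
  ring_nf

theorem indepFun_comp_increment (hz : IsFilteredBrownian P F z) (hsu : s ≤ u) {Y : Ω → ℝ}
    (hY : Measurable[F s.toNNReal] Y) {φ : ℝ → ℝ} (hφ : Measurable φ) :
    IndepFun Y (fun ω ↦ φ (z u.toNNReal ω - z s.toNNReal ω)) P := by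
  have h := hz.indep_increments s.toNNReal u.toNNReal (Real.toNNReal_le_toNNReal hsu)
  rw [IndepFun_iff_Indep]
  exact indep_of_indep_of_le_left
    (indep_of_indep_of_le_right h (hφ.comp (comap_measurable _)).comap_le) hY.comap_le

theorem indepFun_girsanovDensity (hz : IsFilteredBrownian P F z) (θ : ℝ) (hsu : s ≤ u)
    {Y : Ω → ℝ} (hY : Measurable[F s.toNNReal] Y) : IndepFun Y (girsanovDensity z θ s u) P :=
  hz.indepFun_comp_increment hsu hY (φ := fun x ↦ Real.exp (-θ * x + -(θ ^ 2 / 2) * (u - s)))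
    (by fun_prop)

theorem integrable_girsanovDensity (hz : IsFilteredBrownian P F z) (θ : ℝ) (hs : 0 ≤ s)
    (hsu : s ≤ u) : Integrable (girsanovDensity z θ s u) P :=
  hz.integrable_expIncrement _ _ hs hsu

theorem integral_girsanovDensity (hz : IsFilteredBrownian P F z) (θ : ℝ) (hs : 0 ≤ s)
    (hsu : s ≤ u) : ∫ ω, girsanovDensity z θ s u ω ∂P = 1 := by
  rw [girsanovDensity, hz.integral_expIncrement _ _ hs hsu, Real.exp_eq_one_iff]
  ring

theorem integrable_girsanovDensity_sq (hz : IsFilteredBrownian P F z) (θ : ℝ) (hs : 0 ≤ s)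
    (hsu : s ≤ u) : Integrable (fun ω ↦ girsanovDensity z θ s u ω ^ 2) P := by
  simp only [girsanovDensity, expIncrement, ← Real.exp_nat_mul, mul_add, ← mul_assoc]
  exact hz.integrable_expIncrement _ _ hs hsu

theorem integral_girsanovDensity_sq (hz : IsFilteredBrownian P F z) (θ : ℝ) (hs : 0 ≤ s)
    (hsu : s ≤ u) :
    ∫ ω, girsanovDensity z θ s u ω ^ 2 ∂P = Real.exp (θ ^ 2 * (u - s)) := by
  have h := hz.integral_expIncrement (2 * -θ) (2 * -(θ ^ 2 / 2)) hs hsu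
  simp only [girsanovDensity, expIncrement, ← Real.exp_nat_mul, mul_add, ← mul_assoc,
    Nat.cast_ofNat] at h ⊢
  rw [h]
  ring_nf

theorem integrable_girsanovDensity_mul_pow (hz : IsFilteredBrownian P F z) (σ θ : ℝ) (hs : 0 ≤ s)
    (hsu : s ≤ u) (n : ℕ) :
    Integrable (fun ω ↦ girsanovDensity z θ s u ω * discountedReturn z σ θ s u ω ^ n) P := by
  simp only [girsanovDensity_mul_discountedReturn_pow]
  exact hz.integrable_expIncrement _ _ hs hsu

theorem integral_girsanovDensity_mul_pow (hz : IsFilteredBrownian P F z) (σ θ : ℝ) (hs : 0 ≤ s)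
    (hsu : s ≤ u) (n : ℕ) :
    ∫ ω, girsanovDensity z θ s u ω * discountedReturn z σ θ s u ω ^ n ∂P =
      Real.exp (n * (n - 1) / 2 * (σ ^ 2 * (u - s))) := by
  simp only [girsanovDensity_mul_discountedReturn_pow]
  rw [hz.integral_expIncrement _ _ hs hsu]
  ring_nf

theorem girsanovDensity_mul_sub_one_pow (z : ℝ≥0 → Ω → ℝ) (σ θ s u : ℝ) (n : ℕ) (ω : Ω) :
    girsanovDensity z θ s u ω * (discountedReturn z σ θ s u ω - 1) ^ n =
      ∑ k ∈ Finset.range (n + 1), girsanovDensity z θ s u ω * discountedReturn z σ θ s u ω ^ k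
        * ((-1) ^ (n - k) * n.choose k) := by
  rw [sub_eq_add_neg, add_pow, Finset.mul_sum]
  exact Finset.sum_congr rfl fun k _ ↦ by ring

theorem integrable_girsanovDensity_mul_sub_one_pow (hz : IsFilteredBrownian P F z) (σ θ : ℝ)
    (hs : 0 ≤ s) (hsu : s ≤ u) (n : ℕ) :
    Integrable (fun ω ↦ girsanovDensity z θ s u ω * (discountedReturn z σ θ s u ω - 1) ^ n) P := by
  simp only [girsanovDensity_mul_sub_one_pow]
  exact integrable_finsetSum _ fun k _ ↦
    (hz.integrable_girsanovDensity_mul_pow σ θ hs hsu k).mul_const _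

theorem integral_girsanovDensity_mul_sub_one_pow (hz : IsFilteredBrownian P F z) (σ θ : ℝ)
    (hs : 0 ≤ s) (hsu : s ≤ u) (n : ℕ) :
    ∫ ω, girsanovDensity z θ s u ω * (discountedReturn z σ θ s u ω - 1) ^ n ∂P =
      lognormalCentralMoment n (σ ^ 2 * (u - s)) := by
  simp only [girsanovDensity_mul_sub_one_pow]
  rw [integral_finsetSum _ fun k _ ↦
    (hz.integrable_girsanovDensity_mul_pow σ θ hs hsu k).mul_const _]
  simp only [integral_mul_const, hz.integral_girsanovDensity_mul_pow σ θ hs hsu,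
    lognormalCentralMoment]

theorem girsanovDensity_mul_mul_sub_pow (z : ℝ≥0 → Ω → ℝ) (σ θ t s u T h : ℝ) (n : ℕ) (ω : Ω) :
    girsanovDensity z θ t T ω *
        (h * (discountedReturn z σ θ t u ω - discountedReturn z σ θ t s ω) ^ n) =
      girsanovDensity z θ t s ω * discountedReturn z σ θ t s ω ^ n * h
        * (girsanovDensity z θ s u ω * (discountedReturn z σ θ s u ω - 1) ^ n)
        * girsanovDensity z θ u T ω := by
  have hdensity : girsanovDensity z θ t T ω =
      girsanovDensity z θ t s ω * girsanovDensity z θ s u ω * girsanovDensity z θ u T ω := by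
    simp only [girsanovDensity, expIncrement_mul_trans]
  have hreturn : discountedReturn z σ θ t u ω - discountedReturn z σ θ t s ω =
      discountedReturn z σ θ t s ω * (discountedReturn z σ θ s u ω - 1) := by
    rw [mul_sub_one]
    simp only [discountedReturn, expIncrement_mul_trans]
  rw [hdensity, hreturn, mul_pow]
  ring

/-- The three factors in `girsanovDensity_mul_mul_sub_pow` are functions of the past of `s` and of
the increments of `z` over `[s, u]` and `[u, T]`, hence independent. -/
theorem integral_girsanovDensity_mul_mul_sub_pow [IsFiniteMeasure P]
    (hz : IsFilteredBrownian P F z) (σ θ : ℝ) (ht : 0 ≤ t) (hts : t ≤ s) (hsu : s ≤ u)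
    (huT : u ≤ T) {H : Ω → ℝ} (hH : Measurable[F s.toNNReal] H) {N : ℝ} (hHN : ∀ ω, |H ω| ≤ N)
    (n : ℕ) :
    Integrable (fun ω ↦ girsanovDensity z θ t T ω *
      (H ω * (discountedReturn z σ θ t u ω - discountedReturn z σ θ t s ω) ^ n)) P ∧
    ∫ ω, girsanovDensity z θ t T ω *
      (H ω * (discountedReturn z σ θ t u ω - discountedReturn z σ θ t s ω) ^ n) ∂P =
      (∫ ω, girsanovDensity z θ t s ω * discountedReturn z σ θ t s ω ^ n * H ω ∂P)
        * lognormalCentralMoment n (σ ^ 2 * (u - s)) := by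
  simp only [girsanovDensity_mul_mul_sub_pow]
  set past : Ω → ℝ := fun ω ↦ girsanovDensity z θ t s ω * discountedReturn z σ θ t s ω ^ n * H ω
  set increment : Ω → ℝ := fun ω ↦
    girsanovDensity z θ s u ω * (discountedReturn z σ θ s u ω - 1) ^ n
  have hs := ht.trans hts
  have hu := hs.trans hsu
  have hpast : Measurable[F s.toNNReal] past :=
    ((hz.measurable_expIncrement _ _ hts).mul
      ((hz.measurable_expIncrement _ _ hts).pow_const n)).mul hH
  have hpast_int : Integrable past P :=
    (hz.integrable_girsanovDensity_mul_pow σ θ ht hts n).mul_bdd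
      (hH.mono (F.le _) le_rfl).aestronglyMeasurable (.of_forall hHN)
  have hincr_int := hz.integrable_girsanovDensity_mul_sub_one_pow σ θ hs hsu n
  have hindep : IndepFun past increment P :=
    hz.indepFun_comp_increment hsu hpast
      (φ := fun x ↦ Real.exp (-θ * x + -(θ ^ 2 / 2) * (u - s)) *
        (Real.exp (σ * x + (σ * θ - σ ^ 2 / 2) * (u - s)) - 1) ^ n) (by fun_prop)
  have hincr : Measurable[F u.toNNReal] increment :=
    (hz.measurable_expIncrement _ _ hsu).mul
      (((hz.measurable_expIncrement _ _ hsu).sub_const 1).pow_const n)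
  have hindep' : IndepFun (fun ω ↦ past ω * increment ω) (girsanovDensity z θ u T) P :=
    hz.indepFun_girsanovDensity θ huT
      ((hpast.mono (F.mono (Real.toNNReal_le_toNNReal hsu)) le_rfl).mul hincr)
  have hprod_int := hindep.integrable_mul hpast_int hincr_int
  have hdensity_int := hz.integrable_girsanovDensity θ hu huT
  refine ⟨hindep'.integrable_mul hprod_int hdensity_int, ?_⟩
  rw [hindep'.integral_fun_mul_eq_mul_integral hprod_int.aestronglyMeasurable
    hdensity_int.aestronglyMeasurable, hindep.integral_fun_mul_eq_mul_integral
    hpast_int.aestronglyMeasurable hincr_int.aestronglyMeasurable,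
    hz.integral_girsanovDensity θ hu huT, mul_one,
    hz.integral_girsanovDensity_mul_sub_one_pow σ θ hs hsu n]

theorem integral_girsanovDensity_mul_tradingGain [IsFiniteMeasure P]
    (hz : IsFilteredBrownian P F z) (σ θ S : ℝ) {τ : ℕ → ℝ} (hτ : Monotone τ) (hτ0 : 0 ≤ τ 0)
    {n : ℕ} (hτT : τ n ≤ T) {H : ℕ → Ω → ℝ} (hH : ∀ k < n, Measurable[F (τ k).toNNReal] (H k))
    {N : ℝ} (hHN : ∀ k ω, |H k ω| ≤ N) :
    Integrable (fun ω ↦ girsanovDensity z θ (τ 0) T ω *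
      tradingGain (H · ω) (fun k ↦ S * discountedReturn z σ θ (τ 0) (τ k) ω) n) P ∧
    ∫ ω, girsanovDensity z θ (τ 0) T ω *
      tradingGain (H · ω) (fun k ↦ S * discountedReturn z σ θ (τ 0) (τ k) ω) n ∂P = 0 := by
  have hterm : ∀ k ∈ Finset.range n, _ := fun k hk ↦
    have hk := Finset.mem_range.1 hk
    hz.integral_girsanovDensity_mul_mul_sub_pow σ θ hτ0 (hτ k.zero_le) (hτ k.le_succ)
      ((hτ hk).trans hτT) (hH k hk) (hHN k) 1
  have hmoment : ∀ v, lognormalCentralMoment 1 v = 0 := fun v ↦ by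
    simp [lognormalCentralMoment, Finset.sum_range_succ]
  have hsum : ∀ ω, girsanovDensity z θ (τ 0) T ω *
      tradingGain (H · ω) (fun k ↦ S * discountedReturn z σ θ (τ 0) (τ k) ω) n =
      ∑ k ∈ Finset.range n, S * (girsanovDensity z θ (τ 0) T ω * (H k ω *
        (discountedReturn z σ θ (τ 0) (τ (k + 1)) ω - discountedReturn z σ θ (τ 0) (τ k) ω) ^ 1)) :=
    fun ω ↦ by
      rw [tradingGain, Finset.mul_sum]
      exact Finset.sum_congr rfl fun k _ ↦ by ring
  simp only [hsum]
  refine ⟨integrable_finsetSum _ fun k hk ↦ (hterm k hk).1.const_mul S, ?_⟩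
  rw [integral_finsetSum _ fun k hk ↦ (hterm k hk).1.const_mul S]
  refine Finset.sum_eq_zero fun k hk ↦ ?_
  rw [integral_const_mul, (hterm k hk).2, hmoment, mul_zero, mul_zero]

theorem integral_girsanovDensity_mul_sum_sub_pow_four_le [IsFiniteMeasure P]
    (hz : IsFilteredBrownian P F z) (σ θ S : ℝ) (ht : 0 ≤ t) (htT : t ≤ T) (n : ℕ) :
    Integrable (fun ω ↦ girsanovDensity z θ t T ω * ∑ k ∈ Finset.range n,
      (S * discountedReturn z σ θ t (timeGrid t T n (k + 1)) ω
        - S * discountedReturn z σ θ t (timeGrid t T n k) ω) ^ 4) P ∧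
    ∫ ω, girsanovDensity z θ t T ω * ∑ k ∈ Finset.range n,
      (S * discountedReturn z σ θ t (timeGrid t T n (k + 1)) ω
        - S * discountedReturn z σ θ t (timeGrid t T n k) ω) ^ 4 ∂P ≤
      S ^ 4 * Real.exp (6 * (σ ^ 2 * (T - t)))
        * (n * lognormalCentralMoment 4 (σ ^ 2 * (T - t) / n)) := by
  have hterm : ∀ k ∈ Finset.range n, _ := fun k hk ↦
    have hk := Finset.mem_range.1 hk
    hz.integral_girsanovDensity_mul_mul_sub_pow σ θ ht (timeGrid_mem_Icc htT hk.le).1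
      (monotone_timeGrid htT k.le_succ) (timeGrid_mem_Icc htT hk).2
      (measurable_const (a := (1 : ℝ))) (N := 1) (fun _ ↦ by simp) 4
  have hsum : ∀ ω, girsanovDensity z θ t T ω * ∑ k ∈ Finset.range n,
      (S * discountedReturn z σ θ t (timeGrid t T n (k + 1)) ω
        - S * discountedReturn z σ θ t (timeGrid t T n k) ω) ^ 4 =
      ∑ k ∈ Finset.range n, S ^ 4 * (girsanovDensity z θ t T ω * (1 *
        (discountedReturn z σ θ t (timeGrid t T n (k + 1)) ω
          - discountedReturn z σ θ t (timeGrid t T n k) ω) ^ 4)) := fun ω ↦ by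
    rw [Finset.mul_sum]
    exact Finset.sum_congr rfl fun k _ ↦ by ring
  simp only [hsum]
  refine ⟨integrable_finsetSum _ fun k hk ↦ (hterm k hk).1.const_mul _, ?_⟩
  rw [integral_finsetSum _ fun k hk ↦ (hterm k hk).1.const_mul _]
  refine (Finset.sum_le_card_nsmul _ _ (S ^ 4 * Real.exp (6 * (σ ^ 2 * (T - t)))
    * lognormalCentralMoment 4 (σ ^ 2 * (T - t) / n)) fun k hk ↦ ?_).trans_eq ?_
  · obtain ⟨htk, hkT⟩ := timeGrid_mem_Icc htT (Finset.mem_range.1 hk).le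
    have hmoment : 0 ≤ lognormalCentralMoment 4 (σ ^ 2 * (T - t) / n) :=
      lognormalCentralMoment_four_nonneg
        (div_nonneg (mul_nonneg (sq_nonneg σ) (sub_nonneg.2 htT)) n.cast_nonneg)
    rw [integral_const_mul, (hterm k hk).2]
    simp only [mul_one]
    rw [hz.integral_girsanovDensity_mul_pow σ θ ht htk, timeGrid_succ_sub, ← mul_div_assoc,
      ← mul_assoc]
    gcongr
    norm_num
  · rw [Finset.card_range, nsmul_eq_mul]
    ring

end IsFilteredBrownian

end BrownianExponential

section Probability

variable {Ω : Type*} {mΩ : MeasurableSpace Ω} {P : Measure Ω}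

theorem sq_setIntegral_le_measureReal_mul_integral_sq [IsFiniteMeasure P] {f : Ω → ℝ}
    (hf : Integrable f P) (hf2 : Integrable (fun ω ↦ f ω ^ 2) P) (B : Set Ω) :
    (∫ ω in B, f ω ∂P) ^ 2 ≤ P.real B * ∫ ω, f ω ^ 2 ∂P := by
  have hquadratic : ∀ x : ℝ, 0 ≤ P.real B * (x * x) + -(2 * ∫ ω in B, f ω ∂P) * x
      + ∫ ω in B, f ω ^ 2 ∂P := fun x ↦ by
    have hexpand : ∫ ω in B, (f ω - x) ^ 2 ∂P = (∫ ω in B, f ω ^ 2 ∂P)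
        - (∫ ω in B, f ω ∂P) * (2 * x) + P.real B * (x * x) := by
      have hlinear : Integrable (fun ω ↦ f ω ^ 2 - f ω * (2 * x)) (P.restrict B) :=
        hf2.restrict.sub (hf.restrict.mul_const _)
      have hsq : ∀ ω, (f ω - x) ^ 2 = f ω ^ 2 - f ω * (2 * x) + x * x := fun ω ↦ by ring
      simp only [hsq]
      rw [integral_add hlinear (integrable_const _),
        integral_sub hf2.restrict (hf.restrict.mul_const _), integral_mul_const,
        setIntegral_const, smul_eq_mul]
    have hnonneg : 0 ≤ ∫ ω in B, (f ω - x) ^ 2 ∂P := integral_nonneg fun ω ↦ sq_nonneg _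
    linarith
  have hdiscrim := discrim_le_zero hquadratic
  have hrestrict : ∫ ω in B, f ω ^ 2 ∂P ≤ ∫ ω, f ω ^ 2 ∂P :=
    setIntegral_le_integral hf2 (.of_forall fun ω ↦ sq_nonneg _)
  have hmul := mul_le_mul_of_nonneg_left hrestrict (measureReal_nonneg (μ := P) (s := B))
  rw [discrim] at hdiscrim
  linarith

/-- With `Λ` a density, Markov's inequality bounds the weighted probability of `2 * b ≤ G` by `1/2`,
and the Cauchy–Schwarz inequality returns to `P`. -/
theorem one_le_four_mul_integral_sq_mul_measureReal_lt [IsFiniteMeasure P] {Λ G Y : Ω → ℝ} {b : ℝ}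
    (hΛ : ∀ ω, 0 ≤ Λ ω) (hΛ_int : Integrable Λ P) (hΛ_one : ∫ ω, Λ ω ∂P = 1)
    (hΛ_sq : Integrable (fun ω ↦ Λ ω ^ 2) P) (hG : Measurable G)
    (hΛG : Integrable (fun ω ↦ Λ ω * G ω) P) (hΛG_le : ∫ ω, Λ ω * G ω ∂P ≤ 0)
    (hΛY : Integrable (fun ω ↦ Λ ω * Y ω) P) (hΛY_le : ∫ ω, Λ ω * Y ω ∂P ≤ b)
    (hY : ∀ ω, 0 ≤ Y ω) (hYG : ∀ ω, -Y ω ≤ G ω) (hb : 0 < b) :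
    1 ≤ 4 * (∫ ω, Λ ω ^ 2 ∂P) * P.real {ω | G ω < 2 * b} := by
  set B : Set Ω := {ω | G ω < 2 * b}
  have hB : MeasurableSet B := measurableSet_lt hG measurable_const
  have hmarkov : 2 * b * ∫ ω in Bᶜ, Λ ω ∂P ≤ b := by
    calc 2 * b * ∫ ω in Bᶜ, Λ ω ∂P
        = ∫ ω, 2 * b * Bᶜ.indicator Λ ω ∂P := by
          rw [integral_const_mul, integral_indicator hB.compl]
      _ ≤ ∫ ω, (Λ ω * G ω + Λ ω * Y ω) ∂P := by
          refine integral_mono ((hΛ_int.indicator hB.compl).const_mul _) (hΛG.add hΛY) fun ω ↦ ?_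
          by_cases hω : G ω < 2 * b
          · have : 0 ≤ Λ ω * (Y ω + G ω) := mul_nonneg (hΛ ω) (by linarith [hYG ω])
            simp only [B, Set.indicator_of_notMem (show ω ∉ Bᶜ from not_not.2 hω)]
            linarith
          · have : 0 ≤ Λ ω * (G ω + Y ω - 2 * b) := mul_nonneg (hΛ ω) (by linarith [hY ω])
            simp only [B, Set.indicator_of_mem (show ω ∈ Bᶜ from hω)]
            linarith
      _ ≤ b := by rw [integral_add hΛG hΛY]; linarith
  have hhalf : 1 / 2 ≤ ∫ ω in B, Λ ω ∂P := by
    have hsplit := integral_add_compl hB hΛ_int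
    nlinarith
  have hcauchy := sq_setIntegral_le_measureReal_mul_integral_sq hΛ_int hΛ_sq B
  nlinarith

theorem tendsto_measureReal_of_ae_eventually_notMem [IsFiniteMeasure P] {B : ℕ → Set Ω}
    (hB : ∀ n, MeasurableSet (B n)) (h : ∀ᵐ ω ∂P, ∀ᶠ n in Filter.atTop, ω ∉ B n) :
    Filter.Tendsto (fun n ↦ P.real (B n)) Filter.atTop (nhds 0) := by
  have hlim := tendsto_measure_of_ae_tendsto_indicator_of_isFiniteMeasure (μ := P)
    Filter.atTop MeasurableSet.empty hB <| h.mono fun ω hω ↦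
      hω.mono fun n hn ↦ by simpa using hn
  rw [measure_empty] at hlim
  simpa [Function.comp_def, Measure.real] using
    (ENNReal.tendsto_toReal ENNReal.zero_ne_top).comp hlim

theorem one_le_four_mul_integral_sq_mul_measureReal_tradingGain_lt [IsFiniteMeasure P]
    {Λ : Ω → ℝ} {q A : ℕ → Ω → ℝ} {a N : ℝ} {n : ℕ} (hΛ : ∀ ω, 0 ≤ Λ ω) (hΛ_int : Integrable Λ P)
    (hΛ_one : ∫ ω, Λ ω ∂P = 1) (hΛ_sq : Integrable (fun ω ↦ Λ ω ^ 2) P) (ha : 0 ≤ a) (hN : 0 ≤ N)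
    (hgain : Measurable fun ω ↦ tradingGain (stoppedPosition a N (q · ω) (A · ω)) (A · ω) n)
    (hgain_int : Integrable
      (fun ω ↦ Λ ω * tradingGain (stoppedPosition a N (q · ω) (A · ω)) (A · ω) n) P)
    (hgain_le : ∫ ω, Λ ω * tradingGain (stoppedPosition a N (q · ω) (A · ω)) (A · ω) n ∂P ≤ 0)
    (hfourth_int : Integrable
      (fun ω ↦ Λ ω * ∑ k ∈ Finset.range n, (A (k + 1) ω - A k ω) ^ 4) P)
    (hfourth : N ^ 4 * ∫ ω, Λ ω * ∑ k ∈ Finset.range n, (A (k + 1) ω - A k ω) ^ 4 ∂P ≤ 1) :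
    1 ≤ 4 * (∫ ω, Λ ω ^ 2 ∂P) * P.real
      {ω | tradingGain (stoppedPosition a N (q · ω) (A · ω)) (A · ω) n < 2 * (a + 2)} := by
  set Y : Ω → ℝ := fun ω ↦ a + 1 + N ^ 4 * ∑ k ∈ Finset.range n, (A (k + 1) ω - A k ω) ^ 4
    with hYdef
  have hΛY : ∀ ω, Λ ω * Y ω = Λ ω * (a + 1) +
      N ^ 4 * (Λ ω * ∑ k ∈ Finset.range n, (A (k + 1) ω - A k ω) ^ 4) :=
    fun ω ↦ by simp only [hYdef]; ring
  refine one_le_four_mul_integral_sq_mul_measureReal_lt (Y := Y) hΛ hΛ_int hΛ_one hΛ_sq hgain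
    hgain_int hgain_le ?_ ?_ (fun ω ↦ by positivity)
    (fun ω ↦ neg_le_tradingGain_stoppedPosition (q := (q · ω)) (A := (A · ω)) ha hN n)
    (by linarith)
  · simp only [hΛY]
    exact (hΛ_int.mul_const _).add (hfourth_int.const_mul _)
  · simp only [hΛY]
    rw [integral_add (hΛ_int.mul_const _) (hfourth_int.const_mul _), integral_mul_const,
      integral_const_mul, hΛ_one]
    linarith

end Probability

theorem IsFilteredBrownian.le_measureReal_tradingGain_stoppedPosition_lt {Ω : Type*}
    {mΩ : MeasurableSpace Ω} {P : Measure Ω} [IsProbabilityMeasure P] {F : Filtration ℝ≥0 mΩ}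
    {z : ℝ≥0 → Ω → ℝ} (hz : IsFilteredBrownian P F z) (σ θ S : ℝ) {t T : ℝ} (ht : 0 ≤ t)
    (htT : t ≤ T) {a N : ℝ} (ha : 0 ≤ a) (hN : 0 ≤ N) {n : ℕ}
    (hsmall : N ^ 4 * (S ^ 4 * Real.exp (6 * (σ ^ 2 * (T - t)))
      * (n * lognormalCentralMoment 4 (σ ^ 2 * (T - t) / n))) ≤ 1)
    {q : ℕ → Ω → ℝ} (hq : ∀ k ≤ n, Measurable[F (timeGrid t T n k).toNNReal] (q k)) :
    1 / (4 * Real.exp (θ ^ 2 * (T - t))) ≤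
      P.real {ω | tradingGain
        (stoppedPosition a N (q · ω) fun k ↦ S * discountedReturn z σ θ t (timeGrid t T n k) ω)
        (fun k ↦ S * discountedReturn z σ θ t (timeGrid t T n k) ω) n < 2 * (a + 2)} := by
  have hτ0 : timeGrid t T n 0 = t := timeGrid_zero t T n
  have hτ : Monotone (timeGrid t T n) := monotone_timeGrid htT
  have hA : ∀ i k, i ≤ k → Measurable[F (timeGrid t T n k).toNNReal]
      fun ω ↦ S * discountedReturn z σ θ t (timeGrid t T n i) ω := fun i k hik ↦
    ((hz.measurable_expIncrement _ _ (hτ0.symm.trans_le (hτ i.zero_le))).const_mul S).mono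
      (F.mono (Real.toNNReal_le_toNNReal (hτ hik))) le_rfl
  have hH : ∀ k ≤ n, Measurable[F (timeGrid t T n k).toNNReal] fun ω ↦ stoppedPosition a N (q · ω)
      (fun k ↦ S * discountedReturn z σ θ t (timeGrid t T n k) ω) k := fun k hk ↦
    measurable_stoppedPosition a N (fun i hi ↦ (hq i (hi.trans hk)).mono
      (F.mono (Real.toNNReal_le_toNNReal (hτ hi))) le_rfl) fun i hi ↦ hA i k hi
  obtain ⟨hgain_int, hgain_zero⟩ := hz.integral_girsanovDensity_mul_tradingGain σ θ S hτ
    (ht.trans_eq hτ0.symm) (timeGrid_mem_Icc htT le_rfl).2 (fun k hk ↦ hH k hk.le)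
    fun k ω ↦ abs_stoppedPosition_le hN k
  rw [hτ0] at hgain_int hgain_zero
  obtain ⟨hfourth_int, hfourth⟩ :=
    hz.integral_girsanovDensity_mul_sum_sub_pow_four_le σ θ S ht htT n
  have hdensity := one_le_four_mul_integral_sq_mul_measureReal_tradingGain_lt
    (fun ω ↦ (girsanovDensity_pos θ t T ω).le) (hz.integrable_girsanovDensity θ ht htT)
    (hz.integral_girsanovDensity θ ht htT) (hz.integrable_girsanovDensity_sq θ ht htT) ha hN
    (measurable_tradingGain (fun k hk ↦ (hH k hk.le).mono (F.le _) le_rfl)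
      fun k _ ↦ (hA k k le_rfl).mono (F.le _) le_rfl)
    hgain_int hgain_zero.le hfourth_int
    ((mul_le_mul_of_nonneg_left hfourth (pow_nonneg hN 4)).trans hsmall)
  rwa [hz.integral_girsanovDensity_sq θ ht htT, ← div_le_iff₀' (by positivity)] at hdensity

namespace MarketParams

variable {p : MarketParams}

theorem cashValue_le_mul (hlam : 0 ≤ p.lam) (hmu : 0 ≤ p.mu) {S : ℝ} (hS : 0 ≤ S) (y : ℝ) :
    p.cashValue y S ≤ y * S := by
  unfold cashValue
  split_ifs with h
  · nlinarith [mul_nonneg hmu (mul_nonneg hS h)]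
  · nlinarith [mul_nonneg hlam (mul_nonneg hS (by linarith : 0 ≤ -y))]

theorem monotone_cashValue (hlam : 0 ≤ 1 + p.lam) (hmu : p.mu ≤ 1) {S : ℝ} (hS : 0 ≤ S) :
    Monotone (p.cashValue · S) := fun x y hxy ↦ by
  have hsell : 0 ≤ (1 - p.mu) * S := mul_nonneg (sub_nonneg.2 hmu) hS
  have hbuy : 0 ≤ (1 + p.lam) * S := mul_nonneg hlam hS
  simp only [cashValue]
  split_ifs <;> nlinarith

theorem cashValue_le_cashValue_sub_add (hlam : 0 ≤ p.lam) (hmu : 0 ≤ p.mu) {S : ℝ} (hS : 0 ≤ S)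
    {x : ℝ} (hx : 0 ≤ x) (y : ℝ) :
    p.cashValue y S ≤ p.cashValue (y - x) S + (1 + p.lam) * S * x := by
  have hspread : (1 - p.mu) * S ≤ (1 + p.lam) * S := mul_le_mul_of_nonneg_right (by linarith) hS
  unfold cashValue
  split_ifs <;> nlinarith

theorem add_cashValue_le_terminalWealth (hlam : 0 ≤ 1 + p.lam) (hmu : p.mu ≤ 1) (hK : 0 ≤ p.K)
    (j : Scenario) (X y : ℝ) {S : ℝ} (hS : 0 ≤ S) :
    X + p.cashValue (y - 1) S ≤ p.terminalWealth j X y S := by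
  have hmono : p.cashValue (y - 1) S ≤ p.cashValue y S :=
    monotone_cashValue hlam hmu hS (sub_le_self y zero_le_one)
  cases j with
  | one => simpa only [terminalWealth, add_le_add_iff_left] using hmono
  | w => simp only [terminalWealth]; split_ifs <;> linarith

theorem terminalWealth_le (hlam : 0 ≤ p.lam) (hmu : 0 ≤ p.mu) (hK : 0 ≤ p.K) (j : Scenario)
    (X y : ℝ) {S : ℝ} (hS : 0 ≤ S) :
    p.terminalWealth j X y S ≤ X + p.cashValue (y - 1) S + (1 + p.lam) * S + p.K := by
  have hcash := cashValue_le_cashValue_sub_add hlam hmu hS zero_le_one y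
  have hpurchase : 0 ≤ (1 + p.lam) * S := by positivity
  cases j with
  | one => simp only [terminalWealth]; linarith
  | w => simp only [terminalWealth]; split_ifs <;> linarith

variable {Ω : Type*} {mΩ : MeasurableSpace Ω} {P : Measure Ω} {F : Filtration ℝ≥0 mΩ}
  {z : ℝ≥0 → Ω → ℝ}

theorem continuous_stock (t S : ℝ) {ω : Ω} (hω : Continuous (z · ω)) :
    Continuous fun s ↦ p.stock z t S s ω := by
  have : Continuous fun s : ℝ ↦ z s.toNNReal ω := hω.comp continuous_real_toNNReal
  unfold stock
  fun_prop

theorem measurable_stock (hz : IsFilteredBrownian P F z) {t s : ℝ} (S : ℝ) (hts : t ≤ s) :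
    Measurable[F s.toNNReal] (p.stock z t S s) :=
  (Real.measurable_exp.comp
    (((hz.measurable_increment hts).const_mul p.σ).const_add _)).const_mul S

/-- The stock price at time `s`, discounted to time `t`. -/
noncomputable def discountedStock (p : MarketParams) (z : ℝ≥0 → Ω → ℝ) (t S s : ℝ) (ω : Ω) : ℝ :=
  Real.exp (-(p.r * (s - t))) * p.stock z t S s ω

theorem discountedStock_self (t S : ℝ) (ω : Ω) : p.discountedStock z t S t ω = S := by
  simp [discountedStock, stock]

theorem discountedStock_nonneg {S : ℝ} (hS : 0 ≤ S) (t s : ℝ) (ω : Ω) :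
    0 ≤ p.discountedStock z t S s ω :=
  mul_nonneg (Real.exp_pos _).le (mul_nonneg hS (Real.exp_pos _).le)

theorem discountedStock_eq_mul_discountedReturn {θ : ℝ} (hθ : p.α - p.r = p.σ * θ) (t S s : ℝ)
    (ω : Ω) : p.discountedStock z t S s ω = S * discountedReturn z p.σ θ t s ω := by
  rw [discountedStock, stock, discountedReturn, expIncrement, mul_left_comm, ← Real.exp_add, ← hθ]
  ring_nf

theorem continuous_discountedStock (t S : ℝ) {ω : Ω} (hω : Continuous (z · ω)) :
    Continuous fun s ↦ p.discountedStock z t S s ω := by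
  have := p.continuous_stock t S hω
  unfold discountedStock
  fun_prop

namespace Strategy

variable {t X y S : ℝ} (π : p.Strategy P F z t X y S)

theorem L_nonneg (ω : Ω) (s : ℝ) : 0 ≤ π.L ω s :=
  nonneg_of_monotone_of_eq_zero_before (π.L ω).mono (π.L_before ω) s

theorem M_nonneg (ω : Ω) (s : ℝ) : 0 ≤ π.M ω s :=
  nonneg_of_monotone_of_eq_zero_before (π.M ω).mono (π.M_before ω) s

theorem measurable_shares {s : ℝ} (hs : s ∈ Set.Icc t p.T) :
    Measurable[F s.toNNReal] (π.shares s) := by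
  rw [funext fun ω ↦ π.shares_eq ω s hs]
  exact ((π.L_adapted s hs).const_add y).sub (π.M_adapted s hs)

theorem abs_shares_sub_one_le {s : ℝ} (hs : s ∈ Set.Icc t p.T) (ω : Ω) :
    |π.shares s ω - 1| ≤ |y - 1| + (π.L ω p.T + π.M ω p.T) := by
  have hL := (π.L ω).mono hs.2
  have hM := (π.M ω).mono hs.2
  have hL0 := π.L_nonneg ω s
  have hM0 := π.M_nonneg ω s
  have hy := le_abs_self (y - 1)
  have hy' := neg_abs_le (y - 1)
  rw [π.shares_eq ω s hs, abs_le]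
  constructor <;> linarith

/-- The liquidation value of the strategy short of one share at time `s`, discounted to time `t`. -/
noncomputable def discountedWealth (s : ℝ) (ω : Ω) : ℝ :=
  Real.exp (-(p.r * (s - t))) *
    (π.bank s ω + p.cashValue (π.shares s ω - 1) (p.stock z t S s ω))

/-- The event `A_π` that the strategy is solvent at all times of `[t, T]`. -/
def IsSolvent (E : ℝ) (ω : Ω) : Prop :=
  ∀ s ∈ Set.Icc t p.T, p.Solvent E s (π.bank s ω) (π.shares s ω) (p.stock z t S s ω)

/-- The discounted gain over the first `m` of `n` equal periods of `[t, T]` of the frictionless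
portfolio that holds, throughout each period, the number of shares of the strategy at the beginning
of the period less one. -/
noncomputable def gridGain (n m : ℕ) (ω : Ω) : ℝ :=
  tradingGain (fun k ↦ π.shares (timeGrid t p.T n k) ω - 1)
    (fun k ↦ p.discountedStock z t S (timeGrid t p.T n k) ω) m

theorem solvent_iff_lt_discountedWealth (E s : ℝ) (ω : Ω) :
    p.Solvent E s (π.bank s ω) (π.shares s ω) (p.stock z t S s ω) ↔
      -(E * p.discount t) < π.discountedWealth s ω := by
  have hexp : Real.exp (-(p.r * (s - t))) = Real.exp (p.r * (p.T - s)) * p.discount t := by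
    rw [discount, ← Real.exp_add]
    ring_nf
  rw [Solvent, discountedWealth, hexp, ← neg_mul, mul_right_comm, mul_comm (Real.exp _)]
  exact (mul_lt_mul_iff_of_pos_right (Real.exp_pos _)).symm

theorem measurable_discountedWealth (hz : IsFilteredBrownian P F z) {s : ℝ}
    (hs : s ∈ Set.Icc t p.T) : Measurable (π.discountedWealth s) := by
  have hbank : Measurable (π.bank s) := (π.bank_adapted s hs).mono (F.le _) le_rfl
  have hshares : Measurable (π.shares s) := (π.measurable_shares hs).mono (F.le _) le_rfl
  have hstock : Measurable (p.stock z t S s) := (measurable_stock hz S hs.1).mono (F.le _) le_rfl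
  unfold discountedWealth cashValue
  refine (hbank.add (Measurable.ite (measurableSet_le measurable_const (hshares.sub_const 1))
    ?_ ?_)).const_mul _ <;> fun_prop

theorem measurable_gridGain (hz : IsFilteredBrownian P F z) (htT : t ≤ p.T) {n m : ℕ}
    (hm : m ≤ n) : Measurable (π.gridGain n m) :=
  measurable_tradingGain
    (fun _ hk ↦ ((π.measurable_shares (timeGrid_mem_Icc htT (hk.le.trans hm))).sub_const 1).mono
      (F.le _) le_rfl)
    fun _ hk ↦ ((measurable_stock hz S (timeGrid_mem_Icc htT (hk.trans hm)).1).mono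
      (F.le _) le_rfl).const_mul _

/-- The costs `-lam * ∫ A dL - mu * ∫ A dM` of all trades are nonpositive, and so are those of the
final liquidation. -/
theorem discountedWealth_le (hlam : 0 ≤ p.lam) (hmu : 0 ≤ p.mu) (hS : 0 ≤ S) {ω : Ω}
    (hω : Continuous (z · ω))
    (hbank : ∀ s ∈ Set.Icc t p.T, π.bank s ω = X + (∫ u in t..s, p.r * π.bank u ω)
      - (1 + p.lam) * (∫ u in Set.Icc t s, p.stock z t S u ω ∂(π.L ω).measure)
      + (1 - p.mu) * (∫ u in Set.Icc t s, p.stock z t S u ω ∂(π.M ω).measure))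
    {s : ℝ} (hs : s ∈ Set.Icc t p.T) :
    π.discountedWealth s ω ≤ X + (y + π.L ω s - π.M ω s - 1) * p.discountedStock z t S s ω
      - (∫ u in Set.Icc t s, p.discountedStock z t S u ω ∂(π.L ω).measure)
      + ∫ u in Set.Icc t s, p.discountedStock z t S u ω ∂(π.M ω).measure := by
  simp only [intervalIntegral.integral_const_mul] at hbank
  have hstock := p.continuous_stock t S hω
  have hdiscounted : Real.exp (-(p.r * (s - t))) * π.bank s ω = X
      - (1 + p.lam) * (∫ u in Set.Icc t s, p.discountedStock z t S u ω ∂(π.L ω).measure)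
      + (1 - p.mu) * (∫ u in Set.Icc t s, p.discountedStock z t S u ω ∂(π.M ω).measure) :=
    exp_mul_eq_of_eq_mul_integral_add_setIntegral hstock.continuousOn.integrableOn_Icc
      hstock.continuousOn.integrableOn_Icc hbank s hs
  have hcash : Real.exp (-(p.r * (s - t))) * p.cashValue (π.shares s ω - 1) (p.stock z t S s ω) ≤
      (y + π.L ω s - π.M ω s - 1) * p.discountedStock z t S s ω := by
    rw [discountedStock, mul_left_comm, ← π.shares_eq ω s hs]
    exact mul_le_mul_of_nonneg_left
      (cashValue_le_mul hlam hmu (mul_nonneg hS (Real.exp_pos _).le) _) (Real.exp_pos _).le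
  have hpurchase : 0 ≤ p.lam * ∫ u in Set.Icc t s, p.discountedStock z t S u ω ∂(π.L ω).measure :=
    mul_nonneg hlam (integral_nonneg fun u ↦ discountedStock_nonneg hS t u ω)
  have hsale : 0 ≤ p.mu * ∫ u in Set.Icc t s, p.discountedStock z t S u ω ∂(π.M ω).measure :=
    mul_nonneg hmu (integral_nonneg fun u ↦ discountedStock_nonneg hS t u ω)
  rw [discountedWealth, mul_add, hdiscounted]
  linarith

theorem gridGain_eq (htT : t ≤ p.T) {n m : ℕ} (hm : m ≤ n) (ω : Ω) :
    π.gridGain n m ω = (y - 1) * (p.discountedStock z t S (timeGrid t p.T n m) ω - S)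
      + (∑ k ∈ Finset.range m, π.L ω (timeGrid t p.T n k) *
          (p.discountedStock z t S (timeGrid t p.T n (k + 1)) ω
            - p.discountedStock z t S (timeGrid t p.T n k) ω))
      - ∑ k ∈ Finset.range m, π.M ω (timeGrid t p.T n k) *
          (p.discountedStock z t S (timeGrid t p.T n (k + 1)) ω
            - p.discountedStock z t S (timeGrid t p.T n k) ω) := by
  have htelescope := Finset.sum_range_sub
    (fun k ↦ p.discountedStock z t S (timeGrid t p.T n k) ω) m
  rw [timeGrid_zero, discountedStock_self] at htelescope
  rw [← htelescope, Finset.mul_sum, ← Finset.sum_add_distrib, ← Finset.sum_sub_distrib, gridGain,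
    tradingGain]
  refine Finset.sum_congr rfl fun k hk ↦ ?_
  rw [π.shares_eq ω _ (timeGrid_mem_Icc htT ((Finset.mem_range.1 hk).le.trans hm))]
  ring

theorem discountedWealth_timeGrid_le (htT : t ≤ p.T) (hlam : 0 ≤ p.lam) (hmu : 0 ≤ p.mu)
    (hS : 0 ≤ S) {ω : Ω} (hω : Continuous (z · ω))
    (hbank : ∀ s ∈ Set.Icc t p.T, π.bank s ω = X + (∫ u in t..s, p.r * π.bank u ω)
      - (1 + p.lam) * (∫ u in Set.Icc t s, p.stock z t S u ω ∂(π.L ω).measure)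
      + (1 - p.mu) * (∫ u in Set.Icc t s, p.stock z t S u ω ∂(π.M ω).measure))
    {n m : ℕ} (hm : m ≤ n) {ε : ℝ} (hε : 0 ≤ ε)
    (hosc : ∀ k < m, ∀ u ∈ Set.Ioc (timeGrid t p.T n k) (timeGrid t p.T n (k + 1)),
      |p.discountedStock z t S (timeGrid t p.T n (k + 1)) ω - p.discountedStock z t S u ω| ≤ ε) :
    π.discountedWealth (timeGrid t p.T n m) ω ≤
      X + (y - 1) * S + π.gridGain n m ω + ε * (π.L ω p.T + π.M ω p.T) := by
  have hs := timeGrid_mem_Icc htT hm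
  have hA := p.continuous_discountedStock t S hω
  have hτ : Monotone (timeGrid t p.T n) := monotone_timeGrid htT
  have hL := abs_sub_setIntegral_Icc_sub_sum_le hA hτ
    (by simpa only [timeGrid_zero] using π.L_before ω) hε hosc
  have hM := abs_sub_setIntegral_Icc_sub_sum_le hA hτ
    (by simpa only [timeGrid_zero] using π.M_before ω) hε hosc
  rw [timeGrid_zero] at hL hM
  have hLT : ε * π.L ω (timeGrid t p.T n m) ≤ ε * π.L ω p.T :=
    mul_le_mul_of_nonneg_left ((π.L ω).mono hs.2) hε
  have hMT : ε * π.M ω (timeGrid t p.T n m) ≤ ε * π.M ω p.T :=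
    mul_le_mul_of_nonneg_left ((π.M ω).mono hs.2) hε
  have hwealth := π.discountedWealth_le hlam hmu hS hω hbank hs
  have hL_upper := (abs_le.1 hL).2
  have hM_lower := (abs_le.1 hM).1
  rw [π.gridGain_eq htT hm]
  linarith

theorem eventually_discountedWealth_timeGrid_le (hz : IsFilteredBrownian P F z) (htT : t ≤ p.T)
    (hlam : 0 ≤ p.lam) (hmu : 0 ≤ p.mu) (hS : 0 ≤ S) :
    ∀ᵐ ω ∂P, ∀ᶠ n : ℕ in Filter.atTop, ∀ m ≤ n,
      π.discountedWealth (timeGrid t p.T n m) ω ≤ X + (y - 1) * S + π.gridGain n m ω + 1 := by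
  filter_upwards [hz.isBrownian.cont, π.bank_eq] with ω hω hbank
  set V := π.L ω p.T + π.M ω p.T
  have hV : 0 ≤ V := add_nonneg (π.L_nonneg ω _) (π.M_nonneg ω _)
  have hunif := (isCompact_Icc (a := t) (b := p.T)).uniformContinuousOn_of_continuous
    (p.continuous_discountedStock t S hω).continuousOn
  obtain ⟨η, hη, hosc⟩ := Metric.uniformContinuousOn_iff_le.1 hunif (1 / (V + 1)) (by positivity)
  have hmesh : Filter.Tendsto (fun n : ℕ ↦ (p.T - t) / (n : ℝ)) Filter.atTop (nhds 0) :=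
    tendsto_const_div_atTop_nhds_zero_nat _
  filter_upwards [hmesh.eventually (ge_mem_nhds hη)] with n hn m hm
  have hV1 : 1 / (V + 1) * V ≤ 1 := by
    rw [one_div_mul_eq_div, div_le_one (by positivity)]
    linarith
  refine (π.discountedWealth_timeGrid_le htT hlam hmu hS hω hbank hm (ε := 1 / (V + 1))
    (by positivity) fun k hk u ⟨hku, huk⟩ ↦ ?_).trans (by linarith)
  have hk_mem := timeGrid_mem_Icc htT (hk.le.trans hm)
  have hk1_mem := timeGrid_mem_Icc htT (Nat.succ_le_of_lt (hk.trans_le hm))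
  refine hosc _ hk1_mem u ⟨hk_mem.1.trans hku.le, huk.trans hk1_mem.2⟩ ?_
  rw [Real.dist_eq, abs_of_nonneg (sub_nonneg.2 huk)]
  have := timeGrid_succ_sub t p.T n k
  linarith

theorem discountedWealth_le_of_isSolvent (htT : t ≤ p.T) {E : ℝ} {n : ℕ} (hn : n ≠ 0) {ω : Ω}
    (hsolvent : π.IsSolvent E ω) {c a N b : ℝ}
    (happrox : ∀ m ≤ n, π.discountedWealth (timeGrid t p.T n m) ω ≤ c + π.gridGain n m ω)
    (ha : c + E * p.discount t ≤ a) (hN : ∀ s ∈ Set.Icc t p.T, |π.shares s ω - 1| ≤ N)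
    (hb : tradingGain (stoppedPosition a N (fun k ↦ π.shares (timeGrid t p.T n k) ω - 1)
      fun k ↦ p.discountedStock z t S (timeGrid t p.T n k) ω)
      (fun k ↦ p.discountedStock z t S (timeGrid t p.T n k) ω) n ≤ b) :
    π.discountedWealth p.T ω ≤ c + b := by
  rw [tradingGain_stoppedPosition_eq fun m hm ↦ ?_] at hb
  · have hend := happrox n le_rfl
    rw [timeGrid_self hn] at hend
    exact hend.trans (add_le_add_right hb c)
  · have hmem := timeGrid_mem_Icc htT hm.le
    have hlower := (π.solvent_iff_lt_discountedWealth E _ ω).1 (hsolvent _ hmem)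
    have hgain : -a ≤ π.gridGain n m ω := by linarith [happrox m hm.le]
    exact ⟨hgain, hN _ hmem⟩

theorem le_measureReal_isSolvent_imp_add [IsProbabilityMeasure P] (hz : IsFilteredBrownian P F z)
    {θ : ℝ} (hθ : p.α - p.r = p.σ * θ) (ht : 0 ≤ t) (htT : t ≤ p.T) {E c a V : ℝ}
    (ha : 0 ≤ a) (hca : c + E * p.discount t ≤ a) (hV : 0 ≤ V) {n : ℕ} (hn : n ≠ 0)
    (hsmall : (|y - 1| + V) ^ 4 * (S ^ 4 * Real.exp (6 * (p.σ ^ 2 * (p.T - t)))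
      * (n * lognormalCentralMoment 4 (p.σ ^ 2 * (p.T - t) / n))) ≤ 1) :
    1 / (4 * Real.exp (θ ^ 2 * (p.T - t))) ≤
      P.real {ω | π.IsSolvent E ω → π.discountedWealth p.T ω ≤ c + 2 * (a + 2)}
        + P.real {ω | V < π.L ω p.T + π.M ω p.T}
        + P.real {ω | ∃ m ≤ n,
            c + π.gridGain n m ω < π.discountedWealth (timeGrid t p.T n m) ω} := by
  have hstopped := hz.le_measureReal_tradingGain_stoppedPosition_lt p.σ θ S ht htT ha
    (add_nonneg (abs_nonneg _) hV) hsmall (q := fun k ω ↦ π.shares (timeGrid t p.T n k) ω - 1)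
    fun k hk ↦ (π.measurable_shares (timeGrid_mem_Icc htT hk)).sub_const 1
  simp only [← discountedStock_eq_mul_discountedReturn hθ] at hstopped
  refine hstopped.trans ((measureReal_mono fun ω hω ↦ ?_).trans
    ((measureReal_union_le _ _).trans (add_le_add_left (measureReal_union_le _ _) _)))
  by_cases hVω : V < π.L ω p.T + π.M ω p.T
  · exact .inl (.inr hVω)
  by_cases happrox : ∃ m ≤ n, c + π.gridGain n m ω < π.discountedWealth (timeGrid t p.T n m) ω
  · exact .inr happrox
  push Not at hVω happrox
  exact .inl (.inl fun hsolvent ↦ π.discountedWealth_le_of_isSolvent htT hn hsolvent happrox hca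
    (fun s hs ↦ (π.abs_shares_sub_one_le hs ω).trans (add_le_add_right hVω _)) hω.le)

/-- First `n → ∞`, which removes the discretization error, then `V → ∞`, which removes the bound on
the volume of trade. -/
theorem le_measureReal_isSolvent_imp_discountedWealth_le [IsProbabilityMeasure P]
    (hz : IsFilteredBrownian P F z) {θ : ℝ} (hθ : p.α - p.r = p.σ * θ) (ht : 0 ≤ t)
    (htT : t ≤ p.T) (hlam : 0 ≤ p.lam) (hmu : 0 ≤ p.mu) (hS : 0 ≤ S) {E a : ℝ} (ha : 0 ≤ a)
    (hca : X + (y - 1) * S + 1 + E * p.discount t ≤ a) :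
    1 / (4 * Real.exp (θ ^ 2 * (p.T - t))) ≤ P.real {ω | π.IsSolvent E ω →
      π.discountedWealth p.T ω ≤ X + (y - 1) * S + 1 + 2 * (a + 2)} := by
  set c := X + (y - 1) * S + 1
  set good : Set Ω := {ω | π.IsSolvent E ω → π.discountedWealth p.T ω ≤ c + 2 * (a + 2)}
  have htrade : Filter.Tendsto (fun V : ℕ ↦ P.real {ω | V < π.L ω p.T + π.M ω p.T})
      Filter.atTop (nhds 0) :=
    tendsto_measureReal_of_ae_eventually_notMem
      (fun V ↦ measurableSet_lt measurable_const (((π.L_adapted _ ⟨htT, le_rfl⟩).add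
        (π.M_adapted _ ⟨htT, le_rfl⟩)).mono (F.le _) le_rfl))
      (.of_forall fun ω ↦ (tendsto_natCast_atTop_atTop.eventually_ge_atTop
        (π.L ω p.T + π.M ω p.T)).mono fun V hV ↦ not_lt.2 hV)
  have hgrid : Filter.Tendsto (fun n ↦ P.real {ω | ∃ m ≤ n,
      c + π.gridGain n m ω < π.discountedWealth (timeGrid t p.T n m) ω}) Filter.atTop (nhds 0) := by
    refine tendsto_measureReal_of_ae_eventually_notMem (fun n ↦ ?_) ?_
    · simp only [← exists_prop, Set.ofPred_exists]
      exact .iUnion fun m ↦ .iUnion fun hm ↦ measurableSet_lt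
        ((π.measurable_gridGain hz htT hm).const_add c)
        (π.measurable_discountedWealth hz (timeGrid_mem_Icc htT hm))
    · filter_upwards [π.eventually_discountedWealth_timeGrid_le hz htT hlam hmu hS] with ω hω
      filter_upwards [hω] with n hn ⟨m, hm, hlt⟩
      linarith [hn m hm]
  have hbound : ∀ V : ℕ, 1 / (4 * Real.exp (θ ^ 2 * (p.T - t))) ≤
      P.real good + P.real {ω | V < π.L ω p.T + π.M ω p.T} := fun V ↦ by
    have hsmall := ((tendsto_mul_lognormalCentralMoment_four (p.σ ^ 2 * (p.T - t))).const_mul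
      (S ^ 4 * Real.exp (6 * (p.σ ^ 2 * (p.T - t))))).const_mul ((|y - 1| + V) ^ 4)
    rw [mul_zero, mul_zero] at hsmall
    have hlim := hgrid.const_add (P.real good + P.real {ω | V < π.L ω p.T + π.M ω p.T})
    rw [add_zero] at hlim
    refine ge_of_tendsto hlim ?_
    filter_upwards [hsmall.eventually (ge_mem_nhds one_pos), Filter.eventually_ne_atTop 0]
      with n hn_small hn
    exact π.le_measureReal_isSolvent_imp_add hz hθ ht htT ha hca V.cast_nonneg hn hn_small
  have hlim := htrade.const_add (P.real good)
  rw [add_zero] at hlim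
  exact ge_of_tendsto hlim (.of_forall hbound)

theorem outcome_of_isSolvent (j : Scenario) {E : ℝ} {ω : Ω} (h : π.IsSolvent E ω) :
    p.outcome j E π ω = p.utility (p.terminalWealth j (π.bank p.T ω) (π.shares p.T ω)
      (p.stock z t S p.T ω)) := if_pos h

theorem outcome_of_not_isSolvent (j : Scenario) {E : ℝ} {ω : Ω} (h : ¬π.IsSolvent E ω) :
    p.outcome j E π ω = 1 - Real.exp (p.γ * E) := if_neg h

theorem one_sub_exp_le_outcome (hlam : 0 ≤ 1 + p.lam) (hmu : p.mu ≤ 1) (hγ : 0 ≤ p.γ)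
    (hK : 0 ≤ p.K) (htT : t ≤ p.T) (hS : 0 ≤ S) (j : Scenario) (E : ℝ) (ω : Ω) :
    1 - Real.exp (p.γ * E) ≤ p.outcome j E π ω := by
  by_cases h : π.IsSolvent E ω
  · have hsolvent := h p.T ⟨htT, le_rfl⟩
    rw [Solvent, sub_self, mul_zero, Real.exp_zero, mul_one] at hsolvent
    have hwealth := hsolvent.le.trans (add_cashValue_le_terminalWealth hlam hmu hK j
      (π.bank p.T ω) (π.shares p.T ω) (mul_nonneg hS (Real.exp_pos _).le))
    rw [π.outcome_of_isSolvent j h, utility, sub_le_sub_iff_left, Real.exp_le_exp, ← mul_neg]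
    exact mul_le_mul_of_nonneg_left (neg_le.1 hwealth) hγ
  · exact (π.outcome_of_not_isSolvent j h).ge

theorem outcome_le_one (j : Scenario) (E : ℝ) (ω : Ω) : p.outcome j E π ω ≤ 1 := by
  unfold outcome utility
  split_ifs <;> exact sub_le_self _ (Real.exp_pos _).le

theorem exp_le_one_sub_outcome (hlam : 0 ≤ p.lam) (hmu : 0 ≤ p.mu) (hγ : 0 ≤ p.γ) (hK : 0 ≤ p.K)
    (hS : 0 ≤ S) (j : Scenario) {E C R : ℝ} (hE : 0 ≤ E) (hC : 0 ≤ C) (hR : 0 ≤ R) {ω : Ω}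
    (hwealth : π.IsSolvent E ω → π.discountedWealth p.T ω ≤ C)
    (hstock : p.stock z t S p.T ω ≤ R) :
    Real.exp (-(p.γ * (C / p.discount t + (1 + p.lam) * R + p.K))) ≤ 1 - p.outcome j E π ω := by
  have hdiscount : 0 < p.discount t := Real.exp_pos _
  by_cases h : π.IsSolvent E ω
  · have hliquid : π.bank p.T ω + p.cashValue (π.shares p.T ω - 1) (p.stock z t S p.T ω) ≤
        C / p.discount t := (le_div_iff₀' hdiscount).2 (hwealth h)
    have hterminal := terminalWealth_le hlam hmu hK j (π.bank p.T ω) (π.shares p.T ω)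
      (S := p.stock z t S p.T ω) (mul_nonneg hS (Real.exp_pos _).le)
    have hpurchase : (1 + p.lam) * p.stock z t S p.T ω ≤ (1 + p.lam) * R :=
      mul_le_mul_of_nonneg_left hstock (by linarith)
    rw [π.outcome_of_isSolvent j h, utility, sub_sub_cancel, Real.exp_le_exp, neg_le_neg_iff]
    exact mul_le_mul_of_nonneg_left (by linarith) hγ
  · rw [π.outcome_of_not_isSolvent j h, sub_sub_cancel, Real.exp_le_exp]
    have hbound : 0 ≤ p.γ * (C / p.discount t + (1 + p.lam) * R + p.K) := by positivity
    exact (neg_nonpos.2 hbound).trans (mul_nonneg hγ hE)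

end Strategy

theorem exists_measureReal_lt_stock_le [IsFiniteMeasure P] (hz : IsFilteredBrownian P F z)
    {t : ℝ} (S : ℝ) (htT : t ≤ p.T) {δ : ℝ} (hδ : 0 < δ) :
    ∃ R ≥ 0, P.real {ω | R < p.stock z t S p.T ω} ≤ δ := by
  have hlim : Filter.Tendsto (fun R : ℕ ↦ P.real {ω | R < p.stock z t S p.T ω})
      Filter.atTop (nhds 0) :=
    tendsto_measureReal_of_ae_eventually_notMem
      (fun R ↦ measurableSet_lt measurable_const
        ((measurable_stock hz S htT).mono (F.le _) le_rfl))
      (.of_forall fun ω ↦ (tendsto_natCast_atTop_atTop.eventually_ge_atTop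
        (p.stock z t S p.T ω)).mono fun R hR ↦ not_lt.2 hR)
  obtain ⟨R, hR⟩ := (hlim.eventually (ge_mem_nhds hδ)).exists
  exact ⟨R, R.cast_nonneg, hR⟩

/-- By Markov's inequality, as `1 - outcome` exceeds a fixed positive constant with a probability
that is bounded below uniformly in the strategy. -/
theorem exists_integral_outcome_le [IsProbabilityMeasure P] (hz : IsFilteredBrownian P F z)
    {θ : ℝ} (hθ : p.α - p.r = p.σ * θ) (hlam : 0 ≤ p.lam) (hmu : 0 ≤ p.mu) (hγ : 0 ≤ p.γ)
    (hK : 0 ≤ p.K) (j : Scenario) {E t : ℝ} (hE : 0 ≤ E) (ht : 0 ≤ t) (htT : t ≤ p.T) (X y : ℝ)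
    {S : ℝ} (hS : 0 ≤ S) :
    ∃ ε > 0, ∀ π : p.Strategy P F z t X y S, ∫ ω, p.outcome j E π ω ∂P ≤ 1 - ε := by
  have hbarrier : 0 ≤ E * p.discount t := mul_nonneg hE (Real.exp_pos _).le
  set c := X + (y - 1) * S + 1
  obtain ⟨a, ha, hca, hC⟩ : ∃ a ≥ 0, c + E * p.discount t ≤ a ∧ 0 ≤ c + 2 * (a + 2) :=
    ⟨|c| + E * p.discount t, by positivity, by linarith [le_abs_self c],
      by linarith [neg_abs_le c, abs_nonneg c]⟩
  set δ := 1 / (4 * Real.exp (θ ^ 2 * (p.T - t)))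
  have hδ_pos : 0 < δ := by positivity
  obtain ⟨R, hR, hstock⟩ := exists_measureReal_lt_stock_le (p := p) hz S htT (half_pos hδ_pos)
  set η := Real.exp (-(p.γ * ((c + 2 * (a + 2)) / p.discount t + (1 + p.lam) * R + p.K)))
  have hη : 0 < η := Real.exp_pos _
  refine ⟨min (η * (δ / 2)) 1, by positivity, fun π ↦ ?_⟩
  by_cases hint : Integrable (p.outcome j E π) P
  · have hmarkov := mul_meas_ge_le_integral_of_nonneg (μ := P)
      (f := fun ω ↦ 1 - p.outcome j E π ω)
      (.of_forall fun ω ↦ sub_nonneg.2 (π.outcome_le_one j E ω)) ((integrable_const 1).sub hint) η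
    rw [integral_sub (integrable_const 1) hint, integral_const, probReal_univ, one_smul] at hmarkov
    have hgood := π.le_measureReal_isSolvent_imp_discountedWealth_le hz hθ ht htT hlam hmu hS ha hca
    have hcover : δ ≤ P.real {ω | η ≤ 1 - p.outcome j E π ω}
        + P.real {ω | R < p.stock z t S p.T ω} := by
      refine hgood.trans ((measureReal_mono fun ω hω ↦ ?_).trans (measureReal_union_le _ _))
      rcases lt_or_ge R (p.stock z t S p.T ω) with hRω | hRω
      · exact .inr hRω
      · exact .inl (π.exp_le_one_sub_outcome hlam hmu hγ hK hS j hE hC hR hω hRω)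
    have hmass : η * (δ / 2) ≤ η * P.real {ω | η ≤ 1 - p.outcome j E π ω} :=
      mul_le_mul_of_nonneg_left (by linarith) hη.le
    linarith [min_le_left (η * (δ / 2)) 1]
  · rw [integral_undef hint]
    exact sub_nonneg.2 (min_le_right _ _)

theorem integral_outcome_le_one [IsProbabilityMeasure P] (j : Scenario) (E : ℝ) {t X y S : ℝ}
    (π : p.Strategy P F z t X y S) : ∫ ω, p.outcome j E π ω ∂P ≤ 1 := by
  by_cases hint : Integrable (p.outcome j E π) P
  · simpa using integral_mono hint (integrable_const 1) (π.outcome_le_one j E)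
  · exact (integral_undef hint).trans_le zero_le_one

theorem one_sub_exp_le_integral_outcome [IsProbabilityMeasure P] (hlam : 0 ≤ 1 + p.lam)
    (hmu : p.mu ≤ 1) (hγ : 0 ≤ p.γ) (hK : 0 ≤ p.K) (j : Scenario) {E : ℝ} (hE : 0 ≤ E)
    {t X y S : ℝ} (htT : t ≤ p.T) (hS : 0 ≤ S) (π : p.Strategy P F z t X y S) :
    1 - Real.exp (p.γ * E) ≤ ∫ ω, p.outcome j E π ω ∂P := by
  by_cases hint : Integrable (p.outcome j E π) P
  · simpa using integral_mono (integrable_const (1 - Real.exp (p.γ * E))) hint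
      (π.one_sub_exp_le_outcome hlam hmu hγ hK htT hS j E)
  · rw [integral_undef hint, sub_nonpos, Real.one_le_exp_iff]
    exact mul_nonneg hγ hE

theorem one_sub_exp_le_valueB [IsProbabilityMeasure P] (hlam : 0 ≤ 1 + p.lam) (hmu : p.mu ≤ 1)
    (hγ : 0 ≤ p.γ) (hK : 0 ≤ p.K) (j : Scenario) {E t : ℝ} (hE : 0 ≤ E) (htT : t ≤ p.T) (X y : ℝ)
    {S : ℝ} (hS : 0 ≤ S) : 1 - Real.exp (p.γ * E) ≤ p.valueB P F z j E t X y S := by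
  unfold valueB
  split_ifs
  · rcases isEmpty_or_nonempty (p.Strategy P F z t X y S) with _ | ⟨⟨π⟩⟩
    · rw [Real.iSup_of_isEmpty, sub_nonpos, Real.one_le_exp_iff]
      exact mul_nonneg hγ hE
    · exact le_ciSup_of_le ⟨1, Set.forall_mem_range.2 (integral_outcome_le_one j E)⟩ π
        (one_sub_exp_le_integral_outcome hlam hmu hγ hK j hE htT hS π)
  · exact le_rfl

theorem valueB_lt_one [IsProbabilityMeasure P] (hz : IsFilteredBrownian P F z) {θ : ℝ}
    (hθ : p.α - p.r = p.σ * θ) (hlam : 0 ≤ p.lam) (hmu : 0 ≤ p.mu) (hγ : 0 ≤ p.γ) (hK : 0 ≤ p.K)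
    (j : Scenario) {E t : ℝ} (hE : 0 ≤ E) (ht : 0 ≤ t) (htT : t ≤ p.T) (X y : ℝ) {S : ℝ}
    (hS : 0 ≤ S) : p.valueB P F z j E t X y S < 1 := by
  unfold valueB
  split_ifs
  · rcases isEmpty_or_nonempty (p.Strategy P F z t X y S) with _ | _
    · rw [Real.iSup_of_isEmpty]
      exact one_pos
    · obtain ⟨ε, hε, hbound⟩ :=
        exists_integral_outcome_le hz hθ hlam hmu hγ hK j hE ht htT X y hS
      exact (ciSup_le hbound).trans_lt (sub_lt_self 1 hε)
  · exact sub_lt_self 1 (Real.exp_pos _)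

theorem reducedB_pos [IsProbabilityMeasure P] (hz : IsFilteredBrownian P F z) {θ : ℝ}
    (hθ : p.α - p.r = p.σ * θ) (hlam : 0 ≤ p.lam) (hmu : 0 ≤ p.mu) (hγ : 0 ≤ p.γ) (hK : 0 ≤ p.K)
    (j : Scenario) {E t : ℝ} (hE : 0 ≤ E) (ht : 0 ≤ t) (htT : t ≤ p.T) (X y : ℝ) {S : ℝ}
    (hS : 0 ≤ S) : 0 < p.reducedB P F z j E X t y S :=
  div_pos (sub_pos.2 (valueB_lt_one hz hθ hlam hmu hγ hK j hE ht htT X y hS)) (Real.exp_pos _)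

theorem reducedB_le [IsProbabilityMeasure P] (hlam : 0 ≤ 1 + p.lam) (hmu : p.mu ≤ 1)
    (hγ : 0 ≤ p.γ) (hK : 0 ≤ p.K) (j : Scenario) {E t : ℝ} (hE : 0 ≤ E) (htT : t ≤ p.T) (X y : ℝ)
    {S : ℝ} (hS : 0 ≤ S) :
    p.reducedB P F z j E X t y S ≤ Real.exp (p.γ * (E + X / p.discount t)) := by
  have hvalue := one_sub_exp_le_valueB (P := P) (F := F) (z := z) hlam hmu hγ hK j hE htT X y hS
  rw [reducedB, div_le_iff₀ (Real.exp_pos _), ← Real.exp_add, mul_add, add_neg_cancel_right]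
  linarith

theorem div_discount_le {t : ℝ} (ht : t ∈ Set.Icc 0 p.T) (X : ℝ) :
    X / p.discount t ≤ |X| * Real.exp (|p.r| * p.T) := by
  have hexponent : p.r * (p.T - t) ≤ |p.r| * p.T :=
    mul_le_mul (le_abs_self _) (sub_le_self _ ht.1) (sub_nonneg.2 ht.2) (abs_nonneg _)
  rw [discount, Real.exp_neg, div_inv_eq_mul]
  exact mul_le_mul (le_abs_self X) (Real.exp_le_exp.2 hexponent) (Real.exp_pos _).le
    (abs_nonneg X)

end MarketParams

theorem mainTheorem10 {Ω : Type*} {mΩ : MeasurableSpace Ω} (P : Measure Ω)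
    [IsProbabilityMeasure P] (F : Filtration ℝ≥0 mΩ) (z : ℝ≥0 → Ω → ℝ)
    (hz : IsFilteredBrownian P F z) (p : MarketParams)
    (hσ : 0 < p.σ) (hlam : 0 ≤ p.lam) (hmu : 0 ≤ p.mu) (hmu' : p.mu < 1)
    (hγ : 0 < p.γ) (hK : 0 < p.K) (hT : 0 < p.T)
    (X₀ E₀ : ℝ) (hE₀ : 0 < E₀) :
    ∃ M : ℝ, 0 ≤ M ∧ ∀ j : Scenario, ∀ t ∈ Set.Icc 0 p.T, ∀ y S : ℝ, 0 < S →
      0 < p.reducedB P F z j E₀ X₀ t y S ∧ p.reducedB P F z j E₀ X₀ t y S ≤ M := by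
  have hθ : p.α - p.r = p.σ * ((p.α - p.r) / p.σ) := (mul_div_cancel₀ _ hσ.ne').symm
  refine ⟨Real.exp (p.γ * (E₀ + |X₀| * Real.exp (|p.r| * p.T))), (Real.exp_pos _).le,
    fun j t ht y S hS ↦ ⟨?_, ?_⟩⟩
  · exact MarketParams.reducedB_pos hz hθ hlam hmu hγ.le hK.le j hE₀.le ht.1 ht.2 X₀ y hS.le
  · calc
      p.reducedB P F z j E₀ X₀ t y S ≤ Real.exp (p.γ * (E₀ + X₀ / p.discount t)) :=
        MarketParams.reducedB_le (by linarith) hmu'.le hγ.le hK.le j hE₀.le ht.2 X₀ y hS.le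
      _ ≤ Real.exp (p.γ * (E₀ + |X₀| * Real.exp (|p.r| * p.T))) := by
        gcongr
        exact MarketParams.div_discount_le ht X₀
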